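/- **Setting.** Let $\Pi$ be a finite non-empty set of policies, $\mathcal O$ a measurable space of observations, and $\mathcal M$ a finite class of models. A model $M$ assigns to each $\pi\in\Pi$ a probability measure $M(\cdot|\pi)$ on $\mathcal O$, and has a value function $V_M:\Pi\to[0,1]$. Mixtures of models average both the observation laws and the value functions; $\mathrm{co}(\mathcal S)$ is the set of all finite mixtures of models in $\mathcal S$, and $\pi_M\in\arg\max_\pi V_M(\pi)$. Let $\Phi$ be a family of pairwise disjoint subsets ("cells") of $\mathcal M\times\Pi$, let $\Psi=\bigcup_{\phi\in\Phi}\phi$, and for a distribution $\nu$ on $\mathcal M\times\Pi$ let $M^\nu$ be the mixture $\mathbb E_{(M,\pi^\star)\sim\nu}[M]$. For $\eta>0$, $\rho\in\Delta(\Phi)$, $p\in\Delta(\Pi)$, $\nu\in\Delta(\Psi)$ put $$\mathsf{AIR}^{\Phi}_{\rho,\eta}(p,\nu)=\mathbb E_{\pi\sim p}\,\mathbb E_{(M,\pi^\star)\sim\nu}\,\mathbb E_{o\sim M(\cdot|\pi)}\Big[V_M(\pi^\star)-V_M(\pi)-\tfrac1\eta\mathrm{KL}\big(\nu_\phi(\cdot|\pi,o),\rho\big)\Big],$$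 where $\nu_\phi(\cdot|\pi,o)$ is the posterior distribution of the cell containing $(M,\pi^\star)$, given $(\pi,o)$. Further put $$\mathsf{DEC}_\eta(\mathcal S)=\sup_{\bar M\in\mathrm{co}(\mathcal S)}\ \inf_{p\in\Delta(\Pi)}\ \sup_{M\in\mathcal S}\ \mathbb E_{\pi\sim p}\Big[V_M(\pi_M)-V_M(\pi)-\tfrac1\eta \mathrm{KL}\big(M(\cdot|\pi),\bar M(\cdot|\pi)\big)\Big]$$ for a class of models $\mathcal S$, $$\mathsf{DEC}_\eta(\mathcal M,\Phi)=\sup_{\bar M\in\mathrm{co}(\mathcal M)}\ \inf_{p\in\Delta(\Pi)}\ \sup_{\phi\in\Phi}\ \sup_{\nu\in\Delta(\phi)}\ \mathbb E_{\pi\sim p}\Big[\mathbb E_{(M,\pi^\star)\sim\nu}[V_M(\pi^\star)]-V_{M^\nu}(\pi)-\tfrac1\eta \mathrm{KL}\big(M^\nu(\cdot|\pi),\bar M(\cdot|\pi)\big)\Big],$$ $$\bar{\mathcal M}(\Phi)=\bigcup_{\phi\in\Phi}\mathrm{co}\big(\{M:\exists\pi,\ (M,\pi)\in\phi\}\big),\qquad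 C(\Phi)=\sup_{\phi\in\Phi}\ \sup_{\nu\in\Delta(\phi)}\Big(\mathbb E_{(M,\pi^\star)\sim\nu}[V_M(\pi^\star)]-V_{M^\nu}(\pi_{M^\nu})\Big)$$ (with $C(\Phi)=0$ if $\Psi=\emptyset$). All values lie in $[-\infty,\infty]$, with $0\cdot\infty=0$. A $\Phi$-restricted environment commits to a cell $\phi^\star\in\Phi$ and in each round $t$ selects, possibly at random and depending on the history, a pair $(M_t,\pi_t^\star)\in\phi^\star$; the learner, knowing only the past policies and observations, selects $\pi_t$ (possibly at random) and observes $o_t\sim M_t(\cdot|\pi_t)$. **Statement.** 1. For all $\eta>0$: $\ \sup_{\rho\in\Delta(\Phi)}\sup_{\nu\in\Delta(\Psi)}\inf_{p\in\Delta(\Pi)}\mathsf{AIR}^\Phi_{\rho,\eta}(p,\nu)=\mathsf{DEC}_\eta(\mathcal M,\Phi)$. 2. If $C(\Phi)\le 0$, then for all $\eta>0$: $\ \sup_{\rho\in\Delta(\Phi)}\sup_{\nu\in\Delta(\Psi)}\inf_{p\in\Delta(\Pi)}\mathsf{AIR}^\Phi_{\rho,\eta}(p,\nu)\le\mathsf{DEC}_\eta(\bar{\mathcal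 M}(\Phi))$. 3. If $C(\Phi)>0$, then some cell of $\Phi$ contains two different comparator policies (so $C(\Phi)\le0$ whenever every cell has a single comparator policy); for all $\eta>0$, $\ \sup_{\rho\in\Delta(\Phi)}\sup_{\nu\in\Delta(\Psi)}\inf_{p\in\Delta(\Pi)}\mathsf{AIR}^\Phi_{\rho,\eta}(p,\nu)\ge C(\Phi)$, a positive bound that is independent of $\eta$; and sublinear regret is impossible: there is a $\Phi$-restricted environment against which every learner satisfies $\mathbb E\big[\sum_{t=1}^T (V_{M_t}(\pi_t^\star)-V_{M_t}(\pi_t))\big]\ge C(\Phi)\,T$ for every $T$. -/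

import Mathlib

open MeasureTheory ProbabilityTheory InformationTheory
open scoped ENNReal

namespace DecisionMaking

/-- A model: for every policy a distribution over observations, together with its value function
`V_M`, which takes values in `[0, 1]`. -/
structure Model (Pol O : Type*) [MeasurableSpace O] where
  law : Pol → Measure O
  isProb : ∀ π, IsProbabilityMeasure (law π)
  value : Pol → ℝ
  value_mem : ∀ π, value π ∈ Set.Icc (0 : ℝ) 1

/-- The mixture `M^w` of the models `m k` with weights `w k`: `M^w(· | π) = ∑ k, w k • m k (· | π)`
and `V_{M^w}(π) = ∑ k, w k * V_{m k}(π)`. -/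
noncomputable def mixture {Pol O κ : Type*} [MeasurableSpace O] [Fintype κ]
    (w : κ → ℝ) (hw : w ∈ stdSimplex ℝ κ) (m : κ → Model Pol O) : Model Pol O where
  law π := ∑ k, ENNReal.ofReal (w k) • (m k).law π
  isProb π := by
    constructor
    have h : ∀ k, (m k).law π Set.univ = 1 := fun k => (m k).isProb π |>.measure_univ
    simp only [Measure.coe_finsetSum, Finset.sum_apply, Measure.smul_apply, h, smul_eq_mul,
      mul_one]
    rw [← ENNReal.ofReal_sum_of_nonneg (fun k _ => hw.1 k), hw.2, ENNReal.ofReal_one]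
  value π := ∑ k, w k * (m k).value π
  value_mem π := by
    refine ⟨Finset.sum_nonneg fun k _ => mul_nonneg (hw.1 k) ((m k).value_mem π).1, ?_⟩
    calc ∑ k, w k * (m k).value π ≤ ∑ k, w k :=
          Finset.sum_le_sum fun k _ => mul_le_of_le_one_right (hw.1 k) ((m k).value_mem π).2
      _ = 1 := hw.2

/-- The convex hull of a class of models: all finite mixtures of its members. -/
def co {Pol O : Type*} [MeasurableSpace O] (S : Set (Model Pol O)) : Set (Model Pol O) :=
  {M | ∃ (n : ℕ) (w : Fin n → ℝ) (hw : w ∈ stdSimplex ℝ (Fin n)) (m : Fin n → Model Pol O),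
    (∀ k, m k ∈ S) ∧ M = mixture w hw m}

/-- A policy `π_M` that maximizes `V_M`. -/
noncomputable def Model.opt {Pol O : Type*} [MeasurableSpace O] [Finite Pol] [Nonempty Pol]
    (M : Model Pol O) : Pol :=
  (Finite.exists_max M.value).choose

/-- `Δ(S)` for a finite subset `S` of a finite type. -/
def distOn {κ : Type*} [Fintype κ] (S : Finset κ) : Set (κ → ℝ) :=
  {ν | ν ∈ stdSimplex ℝ κ ∧ ∀ x, x ∉ S → ν x = 0}

/-- `E_{π ∼ p} [g π - (1/η) * D π]` for a real-valued gain `g` and a divergence `D` that may be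
infinite; it is `-∞` exactly if `D` is infinite with positive probability. -/
noncomputable def offset {Pol : Type*} [Fintype Pol]
    (η : ℝ) (p : Pol → ℝ) (g : Pol → ℝ) (D : Pol → ℝ≥0∞) : EReal :=
  ((∑ π, p π * g π : ℝ) : EReal)
    - ((ENNReal.ofReal (1 / η) * ∑ π, ENNReal.ofReal (p π) * D π : ℝ≥0∞) : EReal)

/-- The offset decision-estimation coefficient with KL divergence of a class of models. -/
noncomputable def DEC {Pol O : Type*} [MeasurableSpace O] [Fintype Pol] [Nonempty Pol]
    (η : ℝ) (S : Set (Model Pol O)) : EReal :=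
  ⨆ N ∈ co S, ⨅ p ∈ stdSimplex ℝ Pol, ⨆ M ∈ S,
    offset η p (fun π => M.value M.opt - M.value π) (fun π => klDiv (M.law π) (N.law π))

section Phi

variable {ι Pol O : Type*} [Fintype ι] [Fintype Pol] [MeasurableSpace O]

/-- The models that occur in a set of pairs (model, comparator policy). -/
def cellModels (m : ι → Model Pol O) (φ : Finset (ι × Pol)) : Set (Model Pol O) :=
  {M | ∃ i π, (i, π) ∈ φ ∧ m i = M}

/-- The `Φ`-aware convexification of the model class. -/
def convexification (m : ι → Model Pol O) (Φ : Finset (Finset (ι × Pol))) :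
    Set (Model Pol O) :=
  ⋃ φ ∈ Φ, co (cellModels m φ)

/-- The mixture `M^ν` of the models under a distribution `ν` of pairs (model, comparator). -/
noncomputable def mix (m : ι → Model Pol O) (ν : ι × Pol → ℝ)
    (hν : ν ∈ stdSimplex ℝ (ι × Pol)) : Model Pol O :=
  mixture ν hν (fun ψ => m ψ.1)

/-- `E_{(M, π⋆) ∼ ν} [V_M(π⋆)]`. -/
def comparatorValue (m : ι → Model Pol O) (ν : ι × Pol → ℝ) : ℝ :=
  ∑ ψ, ν ψ * (m ψ.1).value ψ.2

/-- The `Φ`-dependent decision-estimation coefficient. -/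
noncomputable def DECPhi (η : ℝ) (m : ι → Model Pol O) (Φ : Finset (Finset (ι × Pol))) : EReal :=
  ⨆ N ∈ co (Set.range m), ⨅ p ∈ stdSimplex ℝ Pol, ⨆ φ ∈ Φ, ⨆ (ν) (hν : ν ∈ distOn φ),
    offset η p (fun π => comparatorValue m ν - (mix m ν hν.1).value π)
      (fun π => klDiv ((mix m ν hν.1).law π) (N.law π))

/-- The density `M(o | π)` of the observation, with respect to the sum over all models of their
observation laws under `π` (a measure that dominates all of them). -/
noncomputable def density (m : ι → Model Pol O) (i : ι) (π : Pol) (o : O) : ℝ :=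
  (((m i).law π).rnDeriv (∑ j, (m j).law π) o).toReal

/-- The posterior probability `ν(φ | π, o)` of the cell `φ` of `Φ`. -/
noncomputable def posterior (m : ι → Model Pol O) (Φ : Finset (Finset (ι × Pol)))
    (ν : ι × Pol → ℝ) (π : Pol) (o : O) (φ : Φ) : ℝ :=
  (∑ ψ ∈ φ.1, ν ψ * density m ψ.1 π o) / ∑ φ' ∈ Φ, ∑ ψ ∈ φ', ν ψ * density m ψ.1 π o

open Classical in
/-- The KL divergence of two distributions on a finite set. -/
noncomputable def finKL {κ : Type*} [Fintype κ] (a b : κ → ℝ) : ℝ≥0∞ :=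
  if ∃ k, b k = 0 ∧ a k ≠ 0 then ∞ else ENNReal.ofReal (∑ k, a k * Real.log (a k / b k))

/-- `AIR^Φ_{ρ,η}(p, ν)`. -/
noncomputable def AIR (η : ℝ) (m : ι → Model Pol O) (Φ : Finset (Finset (ι × Pol)))
    (ρ : Φ → ℝ) (p : Pol → ℝ) (ν : ι × Pol → ℝ) : EReal :=
  offset η p (fun π => ∑ ψ, ν ψ * ((m ψ.1).value ψ.2 - (m ψ.1).value π))
    (fun π => ∑ ψ, ENNReal.ofReal (ν ψ) *
      ∫⁻ o, finKL (posterior m Φ ν π o) ρ ∂((m ψ.1).law π))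

/-- The value `max_ρ max_ν min_p AIR^Φ_{ρ,η}(p, ν)` with `ρ ∈ Δ(Φ)`, `ν ∈ Δ(Ψ)`, where `Ψ` is the
union of the cells of `Φ`, and `p ∈ Δ(Π)`. -/
noncomputable def AIRValue [DecidableEq ι] [DecidableEq Pol]
    (η : ℝ) (m : ι → Model Pol O) (Φ : Finset (Finset (ι × Pol))) : EReal :=
  ⨆ ρ ∈ stdSimplex ℝ Φ, ⨆ ν ∈ distOn (Φ.biUnion id), ⨅ p ∈ stdSimplex ℝ Pol, AIR η m Φ ρ p ν

/-- `C(Φ)`: the largest advantage, over distributions `ν` on a cell, of the comparator drawn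
jointly with the model over the best policy for the mixture model `M^ν`. -/
noncomputable def comparatorGap [Nonempty Pol] (m : ι → Model Pol O)
    (Φ : Finset (Finset (ι × Pol))) : ℝ :=
  sSup {x | ∃ φ ∈ Φ, ∃ (ν : ι × Pol → ℝ) (hν : ν ∈ distOn φ),
    x = comparatorValue m ν - (mix m ν hν.1).value (mix m ν hν.1).opt}

/-- All comparators in a cell of `Φ` agree. -/
def FixedComparator (Φ : Finset (Finset (ι × Pol))) : Prop :=
  ∀ φ ∈ Φ, ∀ ψ ∈ φ, ∀ ψ' ∈ φ, ψ.2 = ψ'.2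

end Phi

section Game

/-- What happens in one round: the environment's pair (model, comparator), the learner's policy
and the observation. -/
abbrev Round (ι Pol O : Type*) := ((ι × Pol) × Pol) × O

/-- A (randomized) learner: a distribution over policies given the past policies and
observations. -/
structure Learner (Pol O : Type*) [MeasurableSpace Pol] [MeasurableSpace O] where
  act : (t : ℕ) → Kernel (Fin t → Pol × O) Pol
  markov : ∀ t, IsMarkovKernel (act t)

/-- A (randomized) `Φ`-restricted environment: it commits to a cell of `Φ` and selects in every
round a pair (model, comparator) in this cell, based on the whole history. -/
structure Environment {ι Pol : Type*} (O : Type*) [MeasurableSpace ι] [MeasurableSpace Pol]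
    [MeasurableSpace O] (Φ : Finset (Finset (ι × Pol))) where
  cell : Finset (ι × Pol)
  cell_mem : cell ∈ Φ
  select : (t : ℕ) → Kernel (Fin t → Round ι Pol O) (ι × Pol)
  markov : ∀ t, IsMarkovKernel (select t)
  select_mem : ∀ t h, ∀ᵐ ψ ∂(select t h), ψ ∈ cell

variable {ι Pol O : Type*} [Fintype ι] [Fintype Pol]
  [MeasurableSpace ι] [MeasurableSingletonClass ι] [MeasurableSpace Pol]
  [MeasurableSingletonClass Pol] [MeasurableSpace O]

/-- The law of the observation given the round's pair (model, comparator) and policy. -/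
noncomputable def obsKernel (m : ι → Model Pol O) : Kernel ((ι × Pol) × Pol) O :=
  ⟨fun x => (m x.1.1).law x.2, measurable_of_countable _⟩

/-- The law of the next round given the history: environment and learner choose independently
given the history, and then the observation is drawn. -/
noncomputable def stepKernel (m : ι → Model Pol O) {Φ : Finset (Finset (ι × Pol))}
    (E : Environment O Φ) (L : Learner Pol O) (t : ℕ) :
    Kernel (Fin t → Round ι Pol O) (Round ι Pol O) :=
  (E.select t ×ₖ (L.act t).comap (fun h s => ((h s).1.2, (h s).2)) (by fun_prop))
    ⊗ₖ (obsKernel m).prodMkLeft _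

/-- The law of the first `t` rounds. -/
noncomputable def historyLaw (m : ι → Model Pol O) {Φ : Finset (Finset (ι × Pol))}
    (E : Environment O Φ) (L : Learner Pol O) : (t : ℕ) → Measure (Fin t → Round ι Pol O)
  | 0 => Measure.dirac (fun s => s.elim0)
  | t + 1 => (historyLaw m E L t ⊗ₘ stepKernel m E L t).map
      (fun x => (Fin.snoc x.1 x.2 : Fin (t + 1) → Round ι Pol O))

/-- The expected regret after `T` rounds against the comparators chosen by the environment. -/
noncomputable def expectedRegret (m : ι → Model Pol O) {Φ : Finset (Finset (ι × Pol))}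
    (E : Environment O Φ) (L : Learner Pol O) (T : ℕ) : ℝ :=
  ∫ h, ∑ t, ((m (h t).1.1.1).value (h t).1.1.2 - (m (h t).1.1.1).value (h t).1.2)
    ∂(historyLaw m E L T)

end Game

end DecisionMaking

/-!
Both bounds compare `AIR` with the divergence `cellDiv` of the joint law of observation and cell
from the product of a reference model `N` with the cell marginal. By the chain rule, `cellDiv`
exceeds the expected divergence of the posterior of the cell from its marginal, and it is the
average over the cells of the divergences of the conditional mixtures from `N`. If `N = M^ν`, then
replacing the prior `ρ` by the cell marginal only decreases the divergence, so the average over the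
cells is at least `AIR`, and some cell attains it. Conversely, `cellDiv` is jointly convex in `ν`
and agrees with the divergence of `M^ν` from `N` if `ν` lives on a single cell, so the minimax
theorem exchanges the infimum over `p` with the supremum over `ν`. If `C(Φ) > 0`, a maximizing `ν`
on a cell beats every policy by `C(Φ)` and reveals nothing about the cell, and drawing from it
independently in every round forces linear regret.
-/

open scoped NNReal

namespace DecisionMaking

section KullbackLeibler

variable {O κ : Type*} [MeasurableSpace O]

lemma klDiv_withDensity (N : Measure O) [IsFiniteMeasure N] {f : O → ℝ≥0∞} (hf : Measurable f)
    [IsFiniteMeasure (N.withDensity f)] :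
    klDiv (N.withDensity f) N = ∫⁻ o, ENNReal.ofReal (klFun (f o).toReal) ∂N := by
  rw [klDiv_eq_lintegral_klFun_of_ac (withDensity_absolutelyContinuous N f)]
  refine lintegral_congr_ae ?_
  filter_upwards [N.rnDeriv_withDensity hf] with o ho
  rw [ho]

/-- The joint law of an observation and a label on which the observation with label `k` has the
(sub-)law `μ k`. It turns a finite family of measures into a single one, to which the chain rule
and the data processing inequality of the divergence apply. -/
noncomputable def labelled [Fintype κ] [MeasurableSpace κ] (μ : κ → Measure O) :
    Measure (O × κ) :=
  ∑ k, (μ k).map (fun o => (o, k))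

section Labelled

variable [Fintype κ] [MeasurableSpace κ]

instance (μ : κ → Measure O) [∀ k, IsFiniteMeasure (μ k)] : IsFiniteMeasure (labelled μ) := by
  unfold labelled; infer_instance

lemma labelled_apply {s : Set (O × κ)} (hs : MeasurableSet s) (μ : κ → Measure O) :
    labelled μ s = ∑ k, μ k ((fun o => (o, k)) ⁻¹' s) := by
  simp only [labelled, Measure.coe_finsetSum, Finset.sum_apply]
  exact Finset.sum_congr rfl fun k _ => Measure.map_apply measurable_prodMk_right hs

lemma lintegral_labelled (μ : κ → Measure O) {f : O × κ → ℝ≥0∞} (hf : Measurable f) :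
    ∫⁻ x, f x ∂(labelled μ) = ∑ k, ∫⁻ o, f (o, k) ∂(μ k) := by
  rw [labelled, lintegral_finsetSum_measure]
  exact Finset.sum_congr rfl fun k _ => lintegral_map hf measurable_prodMk_right

lemma labelled_map_fst (μ : κ → Measure O) : (labelled μ).map Prod.fst = ∑ k, μ k := by
  ext s hs
  rw [Measure.map_apply measurable_fst hs, labelled_apply (measurable_fst hs)]
  simp [Measure.coe_finsetSum, Finset.sum_apply, Set.preimage]

lemma labelled_prod_singleton [MeasurableSingletonClass κ] (μ : κ → Measure O) {s : Set O}
    (hs : MeasurableSet s) (k : κ) : labelled μ (s ×ˢ {k}) = μ k s := by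
  classical
  rw [labelled_apply (hs.prod (measurableSet_singleton k)), Finset.sum_eq_single k]
  · simp
  · intro j _ hj
    simp [hj]
  · simp

lemma labelled_absolutelyContinuous_iff [MeasurableSingletonClass κ] {μ ν : κ → Measure O} :
    labelled μ ≪ labelled ν ↔ ∀ k, μ k ≪ ν k := by
  refine ⟨fun h k => .mk fun s hs h0 => ?_, fun h => .mk fun s hs h0 => ?_⟩
  · rw [← labelled_prod_singleton μ hs k]
    exact h (by rwa [labelled_prod_singleton ν hs k])
  · rw [labelled_apply hs, Finset.sum_eq_zero_iff] at h0 ⊢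
    exact fun k hk => h k (h0 k hk)

lemma labelled_withDensity [MeasurableSingletonClass κ] (ν : κ → Measure O)
    {f : O × κ → ℝ≥0∞} (hf : Measurable f) :
    (labelled ν).withDensity f = labelled fun k => (ν k).withDensity fun o => f (o, k) := by
  ext s hs
  rw [withDensity_apply _ hs, ← lintegral_indicator hs, lintegral_labelled _ (hf.indicator hs),
    labelled_apply hs]
  refine Finset.sum_congr rfl fun k _ => ?_
  rw [withDensity_apply _ (measurable_prodMk_right hs),
    ← lintegral_indicator (measurable_prodMk_right hs)]
  rfl

theorem klDiv_labelled [MeasurableSingletonClass κ] (μ ν : κ → Measure O)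
    [∀ k, IsFiniteMeasure (μ k)] [∀ k, IsFiniteMeasure (ν k)] :
    klDiv (labelled μ) (labelled ν) = ∑ k, klDiv (μ k) (ν k) := by
  by_cases hac : ∀ k, μ k ≪ ν k
  · set f : O × κ → ℝ≥0∞ := fun x => (μ x.2).rnDeriv (ν x.2) x.1
    have hf : Measurable f :=
      measurable_from_prod_countable_left fun k => Measure.measurable_rnDeriv (μ k) (ν k)
    have hμ : labelled μ = (labelled ν).withDensity f := by
      rw [labelled_withDensity ν hf]
      exact congrArg labelled
        (funext fun k => (Measure.withDensity_rnDeriv_eq (μ k) (ν k) (hac k)).symm)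
    have : IsFiniteMeasure ((labelled ν).withDensity f) := hμ ▸ inferInstance
    rw [hμ, klDiv_withDensity _ hf, lintegral_labelled _ (by fun_prop)]
    exact Finset.sum_congr rfl fun k _ => (klDiv_eq_lintegral_klFun_of_ac (hac k)).symm
  · rw [klDiv_of_not_ac (labelled_absolutelyContinuous_iff.not.mpr hac)]
    obtain ⟨k, hk⟩ := not_forall.mp hac
    exact (ENNReal.sum_eq_top.mpr ⟨k, Finset.mem_univ k, klDiv_of_not_ac hk⟩).symm

end Labelled

instance (r : ℝ) (μ : Measure O) [IsFiniteMeasure μ] :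
    IsFiniteMeasure (ENNReal.ofReal r • μ) :=
  μ.smul_finite ENNReal.ofReal_ne_top

section Sums

variable [Fintype κ]

lemma klDiv_sum_le (μ ν : κ → Measure O) [∀ k, IsFiniteMeasure (μ k)]
    [∀ k, IsFiniteMeasure (ν k)] : klDiv (∑ k, μ k) (∑ k, ν k) ≤ ∑ k, klDiv (μ k) (ν k) := by
  let _ : MeasurableSpace κ := ⊤
  rw [← labelled_map_fst, ← labelled_map_fst, ← klDiv_labelled]
  exact klDiv_map_le _ _ measurable_fst

/-- The law with point masses `ν k`. -/
noncomputable def weightMeasure [MeasurableSpace κ] (ν : κ → ℝ) : Measure κ :=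
  ∑ k, ENNReal.ofReal (ν k) • Measure.dirac k

lemma isProbabilityMeasure_weightMeasure [MeasurableSpace κ] {ν : κ → ℝ}
    (hν : ν ∈ stdSimplex ℝ κ) : IsProbabilityMeasure (weightMeasure ν) := by
  constructor
  simp only [weightMeasure, Measure.coe_finsetSum, Finset.sum_apply, Measure.smul_apply,
    measure_univ, smul_eq_mul, mul_one]
  rw [← ENNReal.ofReal_sum_of_nonneg fun k _ => hν.1 k, hν.2, ENNReal.ofReal_one]

lemma labelled_smul_eq_prod [MeasurableSpace κ] (v : κ → ℝ) (N : Measure O)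
    [IsFiniteMeasure N] :
    labelled (fun k => ENNReal.ofReal (v k) • N) = N.prod (weightMeasure v) := by
  have : IsFiniteMeasure (weightMeasure v) := by unfold weightMeasure; infer_instance
  ext s hs
  rw [labelled_apply hs, Measure.prod_apply_symm hs, weightMeasure, lintegral_finsetSum_measure]
  refine Finset.sum_congr rfl fun k _ => ?_
  rw [lintegral_smul_measure, lintegral_dirac' _ (measurable_measure_prodMk_right hs),
    Measure.smul_apply]

-- The last sum is the expected divergence of the posterior of the label from its prior `v`.
theorem sum_klDiv_smul_eq_add (μ : κ → Measure O) (N : Measure O) [∀ k, IsFiniteMeasure (μ k)]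
    [IsFiniteMeasure N] {v : κ → ℝ} (hv : v ∈ stdSimplex ℝ κ) :
    ∑ k, klDiv (μ k) (ENNReal.ofReal (v k) • N) =
      klDiv (∑ k, μ k) N + ∑ k, klDiv (μ k) (ENNReal.ofReal (v k) • ∑ j, μ j) := by
  let _ : MeasurableSpace κ := ⊤
  have := isProbabilityMeasure_weightMeasure hv
  have : Nonempty κ := by
    by_contra! h
    simp [stdSimplex_of_isEmpty_index] at hv
  have hμ : labelled μ = (∑ k, μ k) ⊗ₘ (labelled μ).condKernel := by
    conv_lhs => rw [← (labelled μ).disintegrate (labelled μ).condKernel, Measure.fst,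
      labelled_map_fst]
  rw [← klDiv_labelled, ← klDiv_labelled, labelled_smul_eq_prod, labelled_smul_eq_prod, hμ,
    ← Measure.compProd_const, ← Measure.compProd_const, klDiv_compProd_eq_add]

end Sums

lemma klDiv_add_le (μ μ' ν ν' : Measure O) [IsFiniteMeasure μ] [IsFiniteMeasure μ']
    [IsFiniteMeasure ν] [IsFiniteMeasure ν'] :
    klDiv (μ + μ') (ν + ν') ≤ klDiv μ ν + klDiv μ' ν' := by
  have hμ : ∀ b, IsFiniteMeasure (cond b μ μ') := by rintro (_ | _) <;> assumption
  have hν : ∀ b, IsFiniteMeasure (cond b ν ν') := by rintro (_ | _) <;> assumption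
  simpa using klDiv_sum_le (fun b => cond b μ μ') (fun b => cond b ν ν')

lemma klDiv_measure_univ_smul_le (μ N : Measure O) [IsFiniteMeasure μ] [IsProbabilityMeasure N]
    (r : ℝ≥0) : klDiv μ (μ Set.univ • N) ≤ klDiv μ (r • N) := by
  rcases eq_zero_or_neZero μ with rfl | hμ
  · simp
  rcases eq_or_ne (klDiv μ (r • N)) ∞ with h | h
  · simp [h]
  have hr : r ≠ 0 := by
    rintro rfl
    simp at h
  obtain ⟨hac, hint⟩ := klDiv_ne_top_iff.mp h
  set a : ℝ≥0 := (μ Set.univ).toNNReal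
  have ha : a ≠ 0 := ENNReal.toNNReal_ne_zero.mpr ⟨NeZero.ne _, measure_ne_top _ _⟩
  have hμa : μ Set.univ • N = (a / r) • r • N := by
    rw [smul_smul, div_mul_cancel₀ _ hr, ← Measure.coe_nnreal_smul,
      ENNReal.coe_toNNReal (measure_ne_top _ _)]
  have hc : a / r ≠ 0 := div_ne_zero ha hr
  have hfin : klDiv μ ((a / r) • r • N) ≠ ∞ := by
    refine klDiv_ne_top (hac.trans (Measure.absolutelyContinuous_smul (by simpa using hc))) ?_
    rw [integrable_congr (llr_smul_nnreal_right hac _ hc)]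
    fun_prop
  have hlog : (a : ℝ) - r ≤ Real.log (a / r : ℝ≥0) * a := by
    have h1 := mul_le_mul_of_nonneg_right
      (Real.one_sub_inv_le_log_of_pos (NNReal.coe_pos.mpr (pos_iff_ne_zero.mpr hc))) a.2
    calc (a : ℝ) - r = (1 - ((a / r : ℝ≥0) : ℝ)⁻¹) * a := by push_cast; field_simp
      _ ≤ _ := h1
  have hμr : μ.real Set.univ = a := rfl
  have hNr : (r • N).real Set.univ = r := by simp
  have hmass : ((a / r : ℝ≥0) - 1 : ℝ) * r = a - r := by push_cast; field_simp
  rw [hμa, ← ENNReal.toReal_le_toReal hfin h, toReal_klDiv_smul_right hac hint hc, hμr, hNr, hmass]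
  linarith

lemma mul_klFun_div {x r : ℝ} (h : r = 0 → x = 0) :
    r * klFun (x / r) = x * Real.log (x / r) + r - x := by
  rcases eq_or_ne r 0 with rfl | hr
  · simp [h rfl]
  · rw [klFun]
    field_simp

lemma klDiv_withDensity_smul (N : Measure O) [IsFiniteMeasure N] {f : O → ℝ} (hf : Measurable f)
    (hf0 : 0 ≤ᵐ[N] f) {r : ℝ} (hr : 0 ≤ r) (h : r = 0 → f =ᵐ[N] 0)
    [IsFiniteMeasure (N.withDensity fun o => ENNReal.ofReal (f o))] :
    klDiv (N.withDensity fun o => ENNReal.ofReal (f o)) (ENNReal.ofReal r • N) =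
      ∫⁻ o, ENNReal.ofReal (r * klFun (f o / r)) ∂N := by
  rcases hr.eq_or_lt with rfl | hr
  · have h0 : (fun o => ENNReal.ofReal (f o)) =ᵐ[N] 0 := by
      filter_upwards [h rfl] with o ho
      simp [ho]
    simp [withDensity_congr_ae h0]
  · have hμ : (N.withDensity fun o => ENNReal.ofReal (f o)) =
        (ENNReal.ofReal r • N).withDensity fun o => ENNReal.ofReal (f o / r) := by
      rw [withDensity_smul_measure, ← withDensity_smul' _ _ ENNReal.ofReal_ne_top]
      congr with o
      rw [Pi.smul_apply, smul_eq_mul, ← ENNReal.ofReal_mul hr.le, mul_div_cancel₀ _ hr.ne']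
    have : IsFiniteMeasure
        ((ENNReal.ofReal r • N).withDensity fun o => ENNReal.ofReal (f o / r)) := hμ ▸ inferInstance
    rw [hμ, klDiv_withDensity _ (by fun_prop), lintegral_smul_measure, smul_eq_mul,
      ← lintegral_const_mul _ (by fun_prop)]
    refine lintegral_congr_ae ?_
    filter_upwards [hf0] with o ho
    rw [ENNReal.toReal_ofReal (div_nonneg ho hr.le), ENNReal.ofReal_mul hr.le]

variable [Fintype κ]

lemma finKL_eq_sum_klFun {a b : κ → ℝ} (ha : a ∈ stdSimplex ℝ κ) (hb : b ∈ stdSimplex ℝ κ)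
    (h : ∀ k, b k = 0 → a k = 0) :
    finKL a b = ∑ k, ENNReal.ofReal (b k * klFun (a k / b k)) := by
  have h0 : ¬ ∃ k, b k = 0 ∧ a k ≠ 0 := fun ⟨k, hk, hk'⟩ => hk' (h k hk)
  rw [finKL, if_neg h0, ← ENNReal.ofReal_sum_of_nonneg fun k _ =>
    mul_nonneg (hb.1 k) (klFun_nonneg (div_nonneg (ha.1 k) (hb.1 k)))]
  simp only [mul_klFun_div (h _), Finset.sum_sub_distrib, Finset.sum_add_distrib, ha.2, hb.2,
    add_sub_cancel_right]

lemma lintegral_finKL_eq_top {N : Measure O} {f : O → κ → ℝ} {ρ : κ → ℝ} {k : κ}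
    (hf : Measurable fun o => f o k) (hρ : ρ k = 0) (h : ¬ (fun o => f o k) =ᵐ[N] 0) :
    ∫⁻ o, finKL (f o) ρ ∂N = ∞ := by
  have hs : MeasurableSet {o | f o k ≠ 0} := (hf (measurableSet_singleton 0)).compl
  rw [← top_le_iff]
  calc ∞ = ∞ * N {o | f o k ≠ 0} := (ENNReal.top_mul h).symm
    _ = ∫⁻ _ in {o | f o k ≠ 0}, ∞ ∂N := (setLIntegral_const _ _).symm
    _ ≤ ∫⁻ o in {o | f o k ≠ 0}, finKL (f o) ρ ∂N := by
        refine setLIntegral_mono' hs fun o ho => ?_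
        rw [finKL, if_pos ⟨k, hρ, ho⟩]
    _ ≤ ∫⁻ o, finKL (f o) ρ ∂N := setLIntegral_le_lintegral _ _

theorem lintegral_finKL {N : Measure O} [IsFiniteMeasure N] {f : O → κ → ℝ}
    (hf : ∀ k, Measurable fun o => f o k) (hf' : ∀ᵐ o ∂N, f o ∈ stdSimplex ℝ κ)
    {ρ : κ → ℝ} (hρ : ρ ∈ stdSimplex ℝ κ)
    [∀ k, IsFiniteMeasure (N.withDensity fun o => ENNReal.ofReal (f o k))] :
    ∫⁻ o, finKL (f o) ρ ∂N =
      ∑ k, klDiv (N.withDensity fun o => ENNReal.ofReal (f o k)) (ENNReal.ofReal (ρ k) • N) := by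
  have hf0 k : 0 ≤ᵐ[N] fun o => f o k := hf'.mono fun o ho => ho.1 k
  by_cases h : ∀ k, ρ k = 0 → (fun o => f o k) =ᵐ[N] 0
  · simp only [klDiv_withDensity_smul N (hf _) (hf0 _) (hρ.1 _) (h _)]
    rw [← lintegral_finsetSum _ fun k _ => by fun_prop]
    refine lintegral_congr_ae ?_
    have h' : ∀ᵐ o ∂N, ∀ k, ρ k = 0 → f o k = 0 :=
      ae_all_iff.mpr fun k => Filter.eventually_imp_distrib_left.mpr (h k)
    filter_upwards [hf', h'] with o ho ho'
    exact finKL_eq_sum_klFun ho hρ ho'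
  · push Not at h
    obtain ⟨k, hk, hk'⟩ := h
    rw [lintegral_finKL_eq_top (hf k) hk hk', eq_comm, ENNReal.sum_eq_top]
    refine ⟨k, Finset.mem_univ k, klDiv_of_not_ac fun hac => hk' ?_⟩
    rw [hk, ENNReal.ofReal_zero, zero_smul, Measure.absolutelyContinuous_zero_iff,
      withDensity_eq_zero_iff (by fun_prop)] at hac
    filter_upwards [hac, hf0 k] with o ho ho'
    exact le_antisymm (ENNReal.ofReal_eq_zero.mp ho) ho'

end KullbackLeibler

section Offset

variable {Pol κ : Type*} [Fintype Pol] {η : ℝ} {p g : Pol → ℝ} {D : Pol → ℝ≥0∞}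

lemma offset_eq_bot (hη : 0 < η) (h : ∑ π, ENNReal.ofReal (p π) * D π = ∞) :
    offset η p g D = ⊥ := by
  have h' : ENNReal.ofReal (1 / η) ≠ 0 := by simpa using hη
  rw [offset, h, ENNReal.mul_top h', EReal.coe_ennreal_top, EReal.sub_top]

lemma offset_eq_coe (hη : 0 < η) (h : ∑ π, ENNReal.ofReal (p π) * D π ≠ ∞) :
    offset η p g D =
      ((∑ π, p π * g π - (∑ π, ENNReal.ofReal (p π) * D π).toReal / η : ℝ) : EReal) := by
  have h' : ENNReal.ofReal (1 / η) * ∑ π, ENNReal.ofReal (p π) * D π =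
      ENNReal.ofReal ((∑ π, ENNReal.ofReal (p π) * D π).toReal / η) := by
    rw [one_div, div_eq_inv_mul, ENNReal.ofReal_mul (by positivity), ENNReal.ofReal_toReal h]
  rw [offset, h', EReal.coe_ennreal_ofReal, max_eq_left (by positivity), EReal.coe_sub]

lemma offset_mono (hp : ∀ π, 0 ≤ p π) {g' : Pol → ℝ} (hg : g ≤ g') {D' : Pol → ℝ≥0∞}
    (hD : D' ≤ D) : offset η p g D ≤ offset η p g' D' := by
  refine EReal.sub_le_sub (EReal.coe_le_coe_iff.2 ?_) (EReal.coe_ennreal_le_coe_ennreal_iff.2 ?_)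
  · exact Finset.sum_le_sum fun π _ => mul_le_mul_of_nonneg_left (hg π) (hp π)
  · gcongr with π
    exact hD π

lemma le_offset (hη : 0 < η) {z : Pol → ℝ} (hp : ∀ π, 0 ≤ p π) (hz : ∀ π, z π ≤ g π)
    (hD : ∀ π, D π ≤ ENNReal.ofReal (η * (g π - z π))) :
    ((∑ π, p π * z π : ℝ) : EReal) ≤ offset η p g D := by
  have hpos : ∀ π, 0 ≤ p π * (η * (g π - z π)) := fun π =>
    mul_nonneg (hp π) (mul_nonneg hη.le (sub_nonneg.2 (hz π)))
  have hle : ∑ π, ENNReal.ofReal (p π) * D π ≤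
      ENNReal.ofReal (∑ π, p π * (η * (g π - z π))) := by
    rw [ENNReal.ofReal_sum_of_nonneg fun π _ => hpos π]
    refine Finset.sum_le_sum fun π _ => ?_
    rw [ENNReal.ofReal_mul (hp π)]
    gcongr
    exact hD π
  have hdiv := ENNReal.toReal_le_of_le_ofReal (Finset.sum_nonneg fun π _ => hpos π) hle
  have hsum : ∑ π, p π * (η * (g π - z π)) = η * (∑ π, p π * g π - ∑ π, p π * z π) := by
    rw [← Finset.sum_sub_distrib, Finset.mul_sum]
    exact Finset.sum_congr rfl fun π _ => by ring
  rw [hsum, ← div_le_iff₀' hη] at hdiv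
  rw [offset_eq_coe hη (ne_top_of_le_ne_top ENNReal.ofReal_ne_top hle), EReal.coe_le_coe_iff]
  linarith

lemma exists_ne_zero_sum_mul_le [Fintype κ] {v : κ → ℝ} (hv : v ∈ stdSimplex ℝ κ) (f : κ → ℝ) :
    ∃ k, v k ≠ 0 ∧ ∑ j, v j * f j ≤ f k := by
  obtain ⟨k₀, -, hk₀⟩ : ∃ k ∈ Finset.univ, v k ≠ 0 :=
    Finset.exists_ne_zero_of_sum_ne_zero (hv.2.symm ▸ one_ne_zero)
  by_contra! hlt
  refine lt_irrefl (∑ j, v j * f j) ?_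
  calc ∑ k, v k * f k < ∑ k, v k * ∑ j, v j * f j := by
        refine Finset.sum_lt_sum (fun k _ => ?_) ⟨k₀, Finset.mem_univ k₀,
          mul_lt_mul_of_pos_left (hlt k₀ hk₀) ((hv.1 k₀).lt_of_ne' hk₀)⟩
        rcases eq_or_ne (v k) 0 with h | h
        · rw [h, zero_mul, zero_mul]
        · exact mul_le_mul_of_nonneg_left (hlt k h).le (hv.1 k)
    _ = ∑ j, v j * f j := by rw [← Finset.sum_mul, hv.2, one_mul]

lemma exists_offset_sum_le [Fintype κ] (hη : 0 < η) {v : κ → ℝ} (hv : v ∈ stdSimplex ℝ κ)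
    (g : κ → Pol → ℝ) (D : κ → Pol → ℝ≥0∞) :
    ∃ k, v k ≠ 0 ∧ offset η p (fun π => ∑ k, v k * g k π)
      (fun π => ∑ k, ENNReal.ofReal (v k) * D k π) ≤ offset η p (g k) (D k) := by
  set E : κ → ℝ≥0∞ := fun k => ∑ π, ENNReal.ofReal (p π) * D k π
  have hE : ∑ π, ENNReal.ofReal (p π) * ∑ k, ENNReal.ofReal (v k) * D k π =
      ∑ k, ENNReal.ofReal (v k) * E k := by
    simp only [E, Finset.mul_sum]
    rw [Finset.sum_comm]
    simp only [mul_left_comm]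
  have hg : ∑ π, p π * ∑ k, v k * g k π = ∑ k, v k * ∑ π, p π * g k π := by
    simp only [Finset.mul_sum]
    rw [Finset.sum_comm]
    simp only [mul_left_comm]
  obtain ⟨k, hk, hle⟩ :=
    exists_ne_zero_sum_mul_le hv fun k => ∑ π, p π * g k π - (E k).toReal / η
  refine ⟨k, hk, ?_⟩
  by_cases htop : ∑ k, ENNReal.ofReal (v k) * E k = ∞
  · exact (offset_eq_bot hη (hE.trans htop)).trans_le bot_le
  have hEk : E k ≠ ∞ := fun h => htop <| ENNReal.sum_eq_top.2
    ⟨k, Finset.mem_univ k, by rw [h, ENNReal.mul_top (by simpa using (hv.1 k).lt_of_ne' hk)]⟩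
  rw [offset_eq_coe hη (hE ▸ htop :), offset_eq_coe hη hEk, hE, hg, EReal.coe_le_coe_iff]
  refine le_of_eq_of_le ?_ hle
  rw [ENNReal.toReal_sum (ENNReal.sum_ne_top.1 htop), Finset.sum_div, ← Finset.sum_sub_distrib]
  refine Finset.sum_congr rfl fun k _ => ?_
  rw [ENNReal.toReal_mul, ENNReal.toReal_ofReal (hv.1 k)]
  ring

end Offset

section Minimax

variable {Pol X : Type*}

/-- The real payoff vectors `z` that lie below `g x - D x / η` for some `x ∈ S` with finite
divergence. Phrased through `ENNReal.ofReal`, the condition excludes infinite divergences, so the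
minimax theorem applies to a bilinear real-valued game. -/
def payoffs (η : ℝ) (g : X → Pol → ℝ) (D : X → Pol → ℝ≥0∞) (S : Set X) : Set (Pol → ℝ) :=
  {z | ∃ x ∈ S, ∀ π, z π ≤ g x π ∧ D x π ≤ ENNReal.ofReal (η * (g x π - z π))}

variable {η : ℝ} {g : X → Pol → ℝ} {D : X → Pol → ℝ≥0∞} {S : Set X}

lemma convex_payoffs [AddCommGroup X] [Module ℝ X] (hη : 0 < η) (hS : Convex ℝ S)
    (hg : ∀ π, ConcaveOn ℝ S (g · π))
    (hD : ∀ x ∈ S, ∀ y ∈ S, ∀ a b : ℝ, 0 ≤ a → 0 ≤ b → a + b = 1 → ∀ π,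
      D (a • x + b • y) π ≤ ENNReal.ofReal a * D x π + ENNReal.ofReal b * D y π) :
    Convex ℝ (payoffs η g D S) := by
  rintro z ⟨x, hx, hxz⟩ z' ⟨y, hy, hyz⟩ a b ha hb hab
  refine ⟨a • x + b • y, hS hx hy ha hb hab, fun π => ?_⟩
  have hgπ : a * g x π + b * g y π ≤ g (a • x + b • y) π := (hg π).2 hx hy ha hb hab
  have hx0 : 0 ≤ g x π - z π := sub_nonneg.2 (hxz π).1
  have hy0 : 0 ≤ g y π - z' π := sub_nonneg.2 (hyz π).1
  simp only [Pi.add_apply, Pi.smul_apply, smul_eq_mul]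
  refine ⟨by nlinarith, (hD x hx y hy a b ha hb hab π).trans ?_⟩
  calc ENNReal.ofReal a * D x π + ENNReal.ofReal b * D y π
      ≤ ENNReal.ofReal a * ENNReal.ofReal (η * (g x π - z π)) +
          ENNReal.ofReal b * ENNReal.ofReal (η * (g y π - z' π)) := by
        gcongr
        · exact (hxz π).2
        · exact (hyz π).2
    _ = ENNReal.ofReal (η * (a * g x π + b * g y π - (a * z π + b * z' π))) := by
        rw [← ENNReal.ofReal_mul ha, ← ENNReal.ofReal_mul hb,
          ← ENNReal.ofReal_add (by positivity) (by positivity)]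
        ring_nf
    _ ≤ ENNReal.ofReal (η * (g (a • x + b • y) π - (a * z π + b * z' π))) := by gcongr

variable [Fintype Pol]

lemma iInf_iSup_dotProduct [Nonempty Pol] {Z : Set (Pol → ℝ)} (hZ : Convex ℝ Z) :
    ⨅ p ∈ stdSimplex ℝ Pol, ⨆ z ∈ Z, ((∑ π, p π * z π : ℝ) : EReal) =
      ⨆ z ∈ Z, ⨅ p ∈ stdSimplex ℝ Pol, ((∑ π, p π * z π : ℝ) : EReal) := by
  classical
  have hleft : ∀ z : Pol → ℝ, IsLinearMap ℝ fun p : Pol → ℝ => ∑ π, p π * z π := fun z =>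
    ⟨fun p q => add_dotProduct p q z, fun c p => smul_dotProduct c p z⟩
  have hright : ∀ p : Pol → ℝ, IsLinearMap ℝ fun z : Pol → ℝ => ∑ π, p π * z π := fun p =>
    ⟨fun y z => dotProduct_add p y z, fun c z => dotProduct_smul c p z⟩
  have hmono : Monotone ((↑) : ℝ → EReal) := EReal.coe_strictMono.monotone
  refine Sion.minimax' ⟨_, single_mem_stdSimplex ℝ (Classical.arbitrary Pol)⟩
    (convex_stdSimplex ℝ Pol) (isCompact_stdSimplex ℝ Pol) (fun z _ => ?_) (fun z _ => ?_)
    hZ (fun p _ => ?_) fun p _ => ?_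
  · exact (continuous_coe_real_ereal.comp (by fun_prop)).lowerSemicontinuous
      |>.lowerSemicontinuousOn _
  · exact (((hleft z).mk' _).convexOn (convex_stdSimplex ℝ Pol)).quasiconvexOn.monotone_comp
      (g := Real.toEReal) hmono
  · exact (continuous_coe_real_ereal.comp (by fun_prop)).upperSemicontinuous
      |>.upperSemicontinuousOn _
  · exact (((hright p).mk' _).concaveOn hZ).quasiconcaveOn.monotone_comp
      (g := Real.toEReal) hmono

lemma exists_pos_sum_mul_le {Z : Set (Pol → ℝ)} {B c d : ℝ} (hB : ∀ z ∈ Z, ∀ π, z π ≤ B)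
    {p : Pol → ℝ} (hp : p ∈ stdSimplex ℝ Pol) (hpc : ∀ z ∈ Z, ∑ π, p π * z π ≤ c) (hcd : c < d) :
    ∃ q ∈ stdSimplex ℝ Pol, (∀ π, 0 < q π) ∧ ∀ z ∈ Z, ∑ π, q π * z π ≤ d := by
  obtain ⟨ε, hε0, hε1, hε⟩ : ∃ ε, 0 < ε ∧ ε < 1 ∧ (1 - ε) * c + ε * B < d := by
    have hcont : Continuous fun ε : ℝ => (1 - ε) * c + ε * B := by fun_prop
    have hev : ∀ᶠ ε in nhdsWithin (0 : ℝ) (Set.Ioi 0), (1 - ε) * c + ε * B < d :=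
      (hcont.tendsto' 0 c (by simp)).mono_left nhdsWithin_le_nhds |>.eventually_lt_const hcd
    obtain ⟨ε, h, hε0, hε1⟩ := (hev.and (Ioo_mem_nhdsGT one_pos)).exists
    exact ⟨ε, hε0, hε1, h⟩
  have hne : Nonempty Pol := by
    by_contra! h
    simpa using hp.2
  have hcard : (0 : ℝ) < Fintype.card Pol := by exact_mod_cast Fintype.card_pos
  set u : Pol → ℝ := fun _ => (Fintype.card Pol : ℝ)⁻¹
  have hu : u ∈ stdSimplex ℝ Pol := ⟨fun _ => by positivity, by simp [u, hcard.ne']⟩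
  refine ⟨(1 - ε) • p + ε • u, convex_stdSimplex ℝ Pol hp hu (by linarith) hε0.le (by ring),
    fun π => ?_, fun z hz => ?_⟩
  · exact add_pos_of_nonneg_of_pos (mul_nonneg (by linarith) (hp.1 π))
      (mul_pos hε0 (inv_pos.2 hcard))
  · have huB : ∑ π, u π * z π ≤ B := calc
      ∑ π, u π * z π ≤ ∑ π, u π * B :=
        Finset.sum_le_sum fun π _ => mul_le_mul_of_nonneg_left (hB z hz π) (hu.1 π)
      _ = B := by rw [← Finset.sum_mul, hu.2, one_mul]
    calc ∑ π, ((1 - ε) • p + ε • u) π * z π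
        = (1 - ε) * ∑ π, p π * z π + ε * ∑ π, u π * z π := by
          simp only [Pi.add_apply, Pi.smul_apply, smul_eq_mul, add_mul, Finset.sum_add_distrib,
            mul_assoc, Finset.mul_sum]
      _ ≤ (1 - ε) * c + ε * B := by
          have : 0 ≤ 1 - ε := by linarith
          gcongr
          exact hpc z hz
      _ ≤ d := hε.le

lemma offset_le_of_payoffs_le (hη : 0 < η) {q : Pol → ℝ} (hq : ∀ π, 0 < q π) {d : ℝ}
    (h : ∀ z ∈ payoffs η g D S, ∑ π, q π * z π ≤ d) {x : X} (hx : x ∈ S) :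
    offset η q (g x) (D x) ≤ d := by
  by_cases htop : ∑ π, ENNReal.ofReal (q π) * D x π = ∞
  · exact (offset_eq_bot hη htop).trans_le bot_le
  have hD : ∀ π, D x π ≠ ∞ := fun π hπ => htop <| ENNReal.sum_eq_top.2
    ⟨π, Finset.mem_univ π, by rw [hπ, ENNReal.mul_top (by simpa using hq π)]⟩
  have hz : (fun π => g x π - (D x π).toReal / η) ∈ payoffs η g D S := by
    refine ⟨x, hx, fun π => ⟨sub_le_self _ (by positivity), ?_⟩⟩
    rw [sub_sub_cancel, mul_div_cancel₀ _ hη.ne', ENNReal.ofReal_toReal (hD π)]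
  rw [offset_eq_coe hη htop, EReal.coe_le_coe_iff,
    ENNReal.toReal_sum (ENNReal.sum_ne_top.1 htop), Finset.sum_div, ← Finset.sum_sub_distrib]
  refine (Finset.sum_le_sum fun π _ => le_of_eq ?_).trans (h _ hz)
  rw [ENNReal.toReal_mul, ENNReal.toReal_ofReal (hq π).le]
  ring

-- Infinite divergences make `offset` discontinuous in `p` at the boundary of the simplex. The
-- bilinear game on `payoffs` has no such defect, and interior `p` do not see the difference.
theorem iInf_iSup_offset_le [Nonempty Pol] [AddCommGroup X] [Module ℝ X] (hη : 0 < η)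
    (hS : Convex ℝ S) (hg : ∀ π, ConcaveOn ℝ S (g · π)) {B : ℝ} (hB : ∀ x ∈ S, ∀ π, g x π ≤ B)
    (hD : ∀ x ∈ S, ∀ y ∈ S, ∀ a b : ℝ, 0 ≤ a → 0 ≤ b → a + b = 1 → ∀ π,
      D (a • x + b • y) π ≤ ENNReal.ofReal a * D x π + ENNReal.ofReal b * D y π) :
    ⨅ p ∈ stdSimplex ℝ Pol, ⨆ x ∈ S, offset η p (g x) (D x) ≤
      ⨆ x ∈ S, ⨅ p ∈ stdSimplex ℝ Pol, offset η p (g x) (D x) := by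
  have hpay : ∀ z ∈ payoffs η g D S, ∀ π, z π ≤ B := fun z ⟨x, hx, hz⟩ π =>
    (hz π).1.trans (hB x hx π)
  calc ⨅ p ∈ stdSimplex ℝ Pol, ⨆ x ∈ S, offset η p (g x) (D x)
      ≤ ⨅ p ∈ stdSimplex ℝ Pol, ⨆ z ∈ payoffs η g D S, ((∑ π, p π * z π : ℝ) : EReal) := by
        refine le_of_forall_gt fun d hd => ?_
        obtain ⟨p, hp, hpd⟩ := by simpa only [iInf_lt_iff, exists_prop] using hd
        obtain ⟨c, hc, hcd⟩ := EReal.lt_iff_exists_real_btwn.1 hpd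
        obtain ⟨c', hcc', hc'd⟩ := EReal.lt_iff_exists_real_btwn.1 hcd
        obtain ⟨q, hq, hq0, hqle⟩ := exists_pos_sum_mul_le hpay hp
          (fun z hz => EReal.coe_le_coe_iff.1 ((le_iSup₂ z hz).trans hc.le))
          (EReal.coe_lt_coe_iff.1 hcc')
        have hqd : ⨆ x ∈ S, offset η q (g x) (D x) ≤ c' :=
          iSup₂_le fun x hx => offset_le_of_payoffs_le hη hq0 hqle hx
        exact (iInf₂_le q hq).trans_lt (hqd.trans_lt hc'd)
    _ = ⨆ z ∈ payoffs η g D S, ⨅ p ∈ stdSimplex ℝ Pol, ((∑ π, p π * z π : ℝ) : EReal) :=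
        iInf_iSup_dotProduct (convex_payoffs hη hS hg hD)
    _ ≤ ⨆ x ∈ S, ⨅ p ∈ stdSimplex ℝ Pol, offset η p (g x) (D x) := by
        refine iSup₂_le fun z ⟨x, hx, hz⟩ => le_iSup₂_of_le x hx ?_
        exact iInf₂_mono fun p hp => le_offset hη hp.1 (fun π => (hz π).1) fun π => (hz π).2

end Minimax

attribute [instance] Model.isProb

section Mixtures

variable {Pol O κ : Type*} [MeasurableSpace O] [Fintype κ]

lemma Model.ext_law_value {M N : Model Pol O} (hlaw : M.law = N.law) (hvalue : M.value = N.value) :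
    M = N := by
  cases M; cases N
  cases hlaw; cases hvalue
  rfl

lemma mixture_congr {w : κ → ℝ} (hw : w ∈ stdSimplex ℝ κ) {m m' : κ → Model Pol O}
    (h : ∀ k, w k ≠ 0 → m k = m' k) : mixture w hw m = mixture w hw m' := by
  refine Model.ext_law_value (funext fun π => ?_) (funext fun π => ?_) <;>
    refine Finset.sum_congr rfl fun k _ => ?_ <;>
    rcases eq_or_ne (w k) 0 with hk | hk
  · simp [hk]
  · rw [h k hk]
  · simp [hk]
  · rw [h k hk]

lemma mixture_mem_co {S : Set (Model Pol O)} {w : κ → ℝ} (hw : w ∈ stdSimplex ℝ κ)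
    {m : κ → Model Pol O} (h : ∀ k, w k ≠ 0 → m k ∈ S) : mixture w hw m ∈ co S := by
  classical
  obtain ⟨k₀, -, hk₀⟩ : ∃ k ∈ Finset.univ, w k ≠ 0 :=
    Finset.exists_ne_zero_of_sum_ne_zero (hw.2.symm ▸ one_ne_zero)
  let m' : κ → Model Pol O := fun k => if w k = 0 then m k₀ else m k
  let e := (Fintype.equivFin κ).symm
  have hwe : w ∘ e ∈ stdSimplex ℝ (Fin (Fintype.card κ)) :=
    ⟨fun k => hw.1 _, (Equiv.sum_comp e w).trans hw.2⟩
  refine ⟨Fintype.card κ, w ∘ e, hwe, m' ∘ e, fun k => ?_, ?_⟩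
  · by_cases hk : w (e k) = 0
    · simpa [m', hk] using h k₀ hk₀
    · simpa [m', hk] using h _ hk
  · rw [mixture_congr hw (m' := m') fun k hk => (if_neg hk).symm]
    exact Model.ext_law_value
      (funext fun π => (Equiv.sum_comp e fun k => ENNReal.ofReal (w k) • (m' k).law π).symm)
      (funext fun π => (Equiv.sum_comp e fun k => w k * (m' k).value π).symm)

lemma subset_co (S : Set (Model Pol O)) : S ⊆ co S := by
  intro M hM
  have hw : (fun _ => 1 : Unit → ℝ) ∈ stdSimplex ℝ Unit := ⟨fun _ => zero_le_one, by simp⟩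
  have hmix : mixture _ hw (fun _ => M) = M :=
    Model.ext_law_value (funext fun π => by simp [mixture]) (funext fun π => by simp [mixture])
  exact hmix ▸ mixture_mem_co hw fun _ _ => hM

lemma Model.value_le_opt [Finite Pol] [Nonempty Pol] (M : Model Pol O) (π : Pol) :
    M.value π ≤ M.value M.opt :=
  (Finite.exists_max M.value).choose_spec π

end Mixtures

section Distributions

variable {κ : Type*}

lemma distOn_mono [Fintype κ] {S T : Finset κ} (h : S ⊆ T) : distOn S ⊆ distOn T := fun _ hν =>
  ⟨hν.1, fun x hx => hν.2 x fun hxS => hx (h hxS)⟩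

lemma convex_distOn [Fintype κ] (S : Finset κ) : Convex ℝ (distOn S) := by
  intro ν hν ν' hν' a b ha hb hab
  refine ⟨convex_stdSimplex ℝ κ hν.1 hν'.1 ha hb hab, fun x hx => ?_⟩
  simp [hν.2 x hx, hν'.2 x hx]

lemma isCompact_distOn [Fintype κ] (S : Finset κ) : IsCompact (distOn S) := by
  have hclosed : IsClosed {ν : κ → ℝ | ∀ x, x ∉ S → ν x = 0} := by
    simp only [Set.ofPred_forall]
    exact isClosed_iInter fun x => isClosed_iInter fun _ =>
      isClosed_eq (continuous_apply x) continuous_const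
  exact (isCompact_stdSimplex ℝ κ).inter_right hclosed

lemma sum_eq_one_of_mem_distOn [Fintype κ] {S : Finset κ} {ν : κ → ℝ} (hν : ν ∈ distOn S) :
    ∑ k ∈ S, ν k = 1 := by
  rw [← hν.1.2]
  exact Finset.sum_subset (Finset.subset_univ S) fun k _ hk => hν.2 k hk

lemma sum_eq_sum_cells [Fintype κ] [DecidableEq κ] {A : Type*} [AddCommMonoid A]
    {Φ : Finset (Finset κ)} (hΦ : (Φ : Set (Finset κ)).PairwiseDisjoint id) {f : κ → A}
    (hf : ∀ k, k ∉ Φ.biUnion id → f k = 0) : ∑ k, f k = ∑ φ : Φ, ∑ k ∈ φ.1, f k := by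
  rw [← Finset.sum_subset (Finset.subset_univ (Φ.biUnion id)) fun k _ hk => hf k hk,
    Finset.sum_biUnion hΦ, Finset.sum_coe_sort Φ fun φ => ∑ k ∈ φ, f k]
  rfl

lemma sum_cell_mem_stdSimplex [Fintype κ] [DecidableEq κ] {Φ : Finset (Finset κ)}
    (hΦ : (Φ : Set (Finset κ)).PairwiseDisjoint id) {ν : κ → ℝ}
    (hν : ν ∈ distOn (Φ.biUnion id)) : (fun φ : Φ => ∑ k ∈ φ.1, ν k) ∈ stdSimplex ℝ Φ :=
  ⟨fun _ => Finset.sum_nonneg fun k _ => hν.1.1 k,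
    (sum_eq_sum_cells hΦ fun k hk => hν.2 k hk).symm.trans hν.1.2⟩

/-- The distribution `ν` conditioned on the event `φ`, which should have positive probability:
division by zero turns `condDist ν φ` into `0` otherwise. -/
noncomputable def condDist (ν : κ → ℝ) (φ : Finset κ) : κ → ℝ :=
  (φ : Set κ).indicator fun k => ν k / ∑ j ∈ φ, ν j

lemma sum_mul_condDist {ν : κ → ℝ} (hν : ∀ k, 0 ≤ ν k) {φ : Finset κ} {k : κ} (hk : k ∈ φ) :
    (∑ j ∈ φ, ν j) * condDist ν φ k = ν k := by
  rw [condDist, Set.indicator_of_mem (Finset.mem_coe.2 hk)]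
  by_cases h : ∑ j ∈ φ, ν j = 0
  · rw [h, (Finset.sum_eq_zero_iff_of_nonneg fun k _ => hν k).1 h k hk, zero_mul]
  · rw [mul_div_cancel₀ _ h]

lemma condDist_mem_distOn [Fintype κ] {ν : κ → ℝ} (hν : ∀ k, 0 ≤ ν k) {φ : Finset κ}
    (hφ : ∑ k ∈ φ, ν k ≠ 0) : condDist ν φ ∈ distOn φ := by
  have hsupp : ∀ k, k ∉ φ → condDist ν φ k = 0 := fun k hk => Set.indicator_of_notMem hk _
  refine ⟨⟨fun k => ?_, ?_⟩, hsupp⟩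
  · exact Set.indicator_nonneg (fun k _ => div_nonneg (hν k) (Finset.sum_nonneg fun j _ => hν j)) k
  · rw [← Finset.sum_subset (Finset.subset_univ φ) fun k _ hk => hsupp k hk]
    refine mul_left_cancel₀ hφ ?_
    rw [Finset.mul_sum, mul_one]
    exact Finset.sum_congr rfl fun k hk => sum_mul_condDist hν hk

end Distributions

section Gain

variable {ι Pol O : Type*} [Fintype ι] [Fintype Pol] [MeasurableSpace O]

/-- The expected regret of `π` when the pair (model, comparator) is drawn from `ν`: the gain term
of `AIR`. -/
def gain (m : ι → Model Pol O) (ν : ι × Pol → ℝ) (π : Pol) : ℝ :=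
  ∑ ψ, ν ψ * ((m ψ.1).value ψ.2 - (m ψ.1).value π)

lemma gain_eq_sub (m : ι → Model Pol O) {ν : ι × Pol → ℝ} (hν : ν ∈ stdSimplex ℝ (ι × Pol))
    (π : Pol) : gain m ν π = comparatorValue m ν - (mix m ν hν).value π := by
  simp only [gain, comparatorValue, mix, mixture, mul_sub, Finset.sum_sub_distrib]

lemma gain_le_one (m : ι → Model Pol O) {ν : ι × Pol → ℝ} (hν : ν ∈ stdSimplex ℝ (ι × Pol))
    (π : Pol) : gain m ν π ≤ 1 := by
  rw [← hν.2]
  refine Finset.sum_le_sum fun ψ _ => mul_le_of_le_one_right (hν.1 ψ) ?_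
  linarith [((m ψ.1).value_mem ψ.2).2, ((m ψ.1).value_mem π).1]

lemma concaveOn_gain (m : ι → Model Pol O) {S : Set (ι × Pol → ℝ)} (hS : Convex ℝ S) (π : Pol) :
    ConcaveOn ℝ S (gain m · π) := by
  have hlin : IsLinearMap ℝ fun ν : ι × Pol → ℝ => gain m ν π :=
    ⟨fun p q => add_dotProduct p q _, fun c p => smul_dotProduct c p _⟩
  exact (hlin.mk' _).concaveOn hS

lemma gain_eq_sum_cells [DecidableEq ι] [DecidableEq Pol] (m : ι → Model Pol O)
    {Φ : Finset (Finset (ι × Pol))} (hΦ : (Φ : Set (Finset (ι × Pol))).PairwiseDisjoint id)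
    {ν : ι × Pol → ℝ} (hν : ν ∈ distOn (Φ.biUnion id)) (π : Pol) :
    gain m ν π = ∑ φ : Φ, (∑ ψ ∈ φ.1, ν ψ) * gain m (condDist ν φ.1) π := by
  rw [gain, sum_eq_sum_cells hΦ fun ψ hψ => by rw [hν.2 ψ hψ, zero_mul]]
  refine Finset.sum_congr rfl fun φ _ => ?_
  rw [gain, ← Finset.sum_subset (Finset.subset_univ φ.1) fun ψ _ hψ => by
    rw [condDist, Set.indicator_of_notMem hψ, zero_mul], Finset.mul_sum]
  refine Finset.sum_congr rfl fun ψ hψ => ?_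
  rw [← mul_assoc, sum_mul_condDist hν.1.1 hψ]

end Gain

section CellLaw

variable {ι Pol O : Type*} [MeasurableSpace O]

/-- The law of the observation under `π`, restricted to the event that the pair (model, comparator)
drawn from `ν` lies in `φ`. Its total mass is the probability of `φ`. -/
noncomputable def cellLaw (m : ι → Model Pol O) (ν : ι × Pol → ℝ) (φ : Finset (ι × Pol))
    (π : Pol) : Measure O :=
  ∑ ψ ∈ φ, ENNReal.ofReal (ν ψ) • (m ψ.1).law π

instance (m : ι → Model Pol O) (ν : ι × Pol → ℝ) (φ : Finset (ι × Pol)) (π : Pol) :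
    IsFiniteMeasure (cellLaw m ν φ π) := by
  unfold cellLaw; infer_instance

lemma cellLaw_univ (m : ι → Model Pol O) {ν : ι × Pol → ℝ} (hν : ∀ ψ, 0 ≤ ν ψ)
    (φ : Finset (ι × Pol)) (π : Pol) :
    cellLaw m ν φ π Set.univ = ENNReal.ofReal (∑ ψ ∈ φ, ν ψ) := by
  simp [cellLaw, ENNReal.ofReal_sum_of_nonneg fun ψ _ => hν ψ]

lemma cellLaw_convexComb (m : ι → Model Pol O) {ν ν' : ι × Pol → ℝ} (hν : ∀ ψ, 0 ≤ ν ψ)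
    (hν' : ∀ ψ, 0 ≤ ν' ψ) {a b : ℝ} (ha : 0 ≤ a) (hb : 0 ≤ b) (φ : Finset (ι × Pol)) (π : Pol) :
    cellLaw m (a • ν + b • ν') φ π =
      ENNReal.ofReal a • cellLaw m ν φ π + ENNReal.ofReal b • cellLaw m ν' φ π := by
  simp only [cellLaw, Finset.smul_sum, ← Finset.sum_add_distrib, smul_smul,
    ← ENNReal.ofReal_mul ha, ← ENNReal.ofReal_mul hb, ← add_smul]
  refine Finset.sum_congr rfl fun ψ _ => ?_
  rw [← ENNReal.ofReal_add (mul_nonneg ha (hν ψ)) (mul_nonneg hb (hν' ψ))]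
  rfl

lemma cellLaw_eq_smul_condDist (m : ι → Model Pol O) {ν : ι × Pol → ℝ} (hν : ∀ ψ, 0 ≤ ν ψ)
    (φ : Finset (ι × Pol)) (π : Pol) :
    cellLaw m ν φ π = ENNReal.ofReal (∑ ψ ∈ φ, ν ψ) • cellLaw m (condDist ν φ) φ π := by
  rw [cellLaw, cellLaw, Finset.smul_sum]
  refine Finset.sum_congr rfl fun ψ hψ => ?_
  rw [smul_smul, ← ENNReal.ofReal_mul (Finset.sum_nonneg fun ψ _ => hν ψ), sum_mul_condDist hν hψ]

variable [Fintype ι] [Fintype Pol]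

lemma cellLaw_eq_mix_law (m : ι → Model Pol O) {φ : Finset (ι × Pol)} {ν : ι × Pol → ℝ}
    (hν : ν ∈ distOn φ) (π : Pol) : cellLaw m ν φ π = (mix m ν hν.1).law π :=
  Finset.sum_subset (Finset.subset_univ φ) fun ψ _ hψ => by
    rw [hν.2 ψ hψ, ENNReal.ofReal_zero, zero_smul]

lemma sum_cellLaw [DecidableEq ι] [DecidableEq Pol] (m : ι → Model Pol O)
    {Φ : Finset (Finset (ι × Pol))} (hΦ : (Φ : Set (Finset (ι × Pol))).PairwiseDisjoint id)
    {ν : ι × Pol → ℝ} (hν : ν ∈ distOn (Φ.biUnion id)) (π : Pol) :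
    ∑ φ : Φ, cellLaw m ν φ.1 π = (mix m ν hν.1).law π :=
  (sum_eq_sum_cells hΦ fun ψ hψ => by rw [hν.2 ψ hψ, ENNReal.ofReal_zero, zero_smul]).symm

end CellLaw

section Posterior

variable {ι Pol O : Type*} [Fintype ι] [MeasurableSpace O] {Φ : Finset (Finset (ι × Pol))}
  {ν : ι × Pol → ℝ} (m : ι → Model Pol O) (π : Pol)

@[fun_prop]
lemma measurable_density (i : ι) : Measurable (density m i π) :=
  (Measure.measurable_rnDeriv _ _).ennreal_toReal

lemma density_nonneg (i : ι) (o : O) : 0 ≤ density m i π o := ENNReal.toReal_nonneg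

lemma sum_mul_density_nonneg (hν : ∀ ψ, 0 ≤ ν ψ) (φ : Finset (ι × Pol)) (o : O) :
    0 ≤ ∑ ψ ∈ φ, ν ψ * density m ψ.1 π o :=
  Finset.sum_nonneg fun ψ _ => mul_nonneg (hν ψ) (density_nonneg m π ψ.1 o)

lemma withDensity_density (i : ι) :
    (∑ j, (m j).law π).withDensity (fun o => ENNReal.ofReal (density m i π o)) =
      (m i).law π := by
  have hac : (m i).law π ≪ ∑ j, (m j).law π :=
    Measure.absolutelyContinuous_of_le <| Finset.single_le_sum
      (f := fun j => (m j).law π) (fun _ _ => Measure.zero_le _) (Finset.mem_univ i)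
  calc _ = (∑ j, (m j).law π).withDensity (((m i).law π).rnDeriv (∑ j, (m j).law π)) := by
        refine withDensity_congr_ae ?_
        filter_upwards [((m i).law π).rnDeriv_lt_top (∑ j, (m j).law π)] with o ho
        exact ENNReal.ofReal_toReal ho.ne
    _ = (m i).law π := Measure.withDensity_rnDeriv_eq _ _ hac

lemma cellLaw_eq_withDensity (hν : ∀ ψ, 0 ≤ ν ψ) (φ : Finset (ι × Pol)) :
    cellLaw m ν φ π = (∑ j, (m j).law π).withDensity
      fun o => ENNReal.ofReal (∑ ψ ∈ φ, ν ψ * density m ψ.1 π o) := by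
  have hsum : (fun o => ENNReal.ofReal (∑ ψ ∈ φ, ν ψ * density m ψ.1 π o)) =
      fun o => ∑ ψ ∈ φ, ENNReal.ofReal (ν ψ) * ENNReal.ofReal (density m ψ.1 π o) := by
    funext o
    rw [ENNReal.ofReal_sum_of_nonneg fun ψ _ => mul_nonneg (hν ψ) (density_nonneg m π ψ.1 o)]
    exact Finset.sum_congr rfl fun ψ _ => ENNReal.ofReal_mul (hν ψ)
  ext s hs
  rw [hsum, withDensity_apply _ hs, lintegral_finsetSum _ fun ψ _ => by fun_prop, cellLaw,
    Measure.coe_finsetSum, Finset.sum_apply]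
  refine Finset.sum_congr rfl fun ψ _ => ?_
  rw [lintegral_const_mul _ (by fun_prop), ← withDensity_apply _ hs, withDensity_density,
    Measure.smul_apply, smul_eq_mul]

variable [Fintype Pol] [DecidableEq ι] [DecidableEq Pol]

lemma mix_law_eq_withDensity (hΦ : (Φ : Set (Finset (ι × Pol))).PairwiseDisjoint id)
    (hν : ν ∈ distOn (Φ.biUnion id)) :
    (mix m ν hν.1).law π = (∑ j, (m j).law π).withDensity
      fun o => ENNReal.ofReal (∑ φ ∈ Φ, ∑ ψ ∈ φ, ν ψ * density m ψ.1 π o) := by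
  have hunion : ∀ o, ∑ φ ∈ Φ, ∑ ψ ∈ φ, ν ψ * density m ψ.1 π o =
      ∑ ψ ∈ Φ.biUnion id, ν ψ * density m ψ.1 π o := fun o => (Finset.sum_biUnion hΦ).symm
  simp only [hunion, ← cellLaw_eq_mix_law m hν π, cellLaw_eq_withDensity m π hν.1.1]

lemma cellLaw_eq_withDensity_posterior (hΦ : (Φ : Set (Finset (ι × Pol))).PairwiseDisjoint id)
    (hν : ν ∈ distOn (Φ.biUnion id)) (φ : Φ) :
    cellLaw m ν φ.1 π = ((mix m ν hν.1).law π).withDensity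
      fun o => ENNReal.ofReal (posterior m Φ ν π o φ) := by
  have hnn := sum_mul_density_nonneg m π hν.1.1
  have hpost : Measurable fun o => posterior m Φ ν π o φ := by unfold posterior; fun_prop
  rw [mix_law_eq_withDensity m π hΦ hν, cellLaw_eq_withDensity m π hν.1.1,
    ← withDensity_mul _ (by fun_prop) hpost.ennreal_ofReal]
  congr with o
  rw [Pi.mul_apply, ← ENNReal.ofReal_mul (Finset.sum_nonneg fun φ _ => hnn φ o), posterior,
    mul_div_cancel_of_imp']
  exact fun h => (Finset.sum_eq_zero_iff_of_nonneg fun φ _ => hnn φ o).1 h φ.1 φ.2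

lemma posterior_mem_stdSimplex_ae (hΦ : (Φ : Set (Finset (ι × Pol))).PairwiseDisjoint id)
    (hν : ν ∈ distOn (Φ.biUnion id)) :
    ∀ᵐ o ∂((mix m ν hν.1).law π), posterior m Φ ν π o ∈ stdSimplex ℝ Φ := by
  have hnn := sum_mul_density_nonneg m π hν.1.1
  rw [mix_law_eq_withDensity m π hΦ hν, ae_withDensity_iff (by fun_prop)]
  refine ae_of_all _ fun o ho => ⟨fun φ => ?_, ?_⟩
  · exact div_nonneg (hnn φ o) (Finset.sum_nonneg fun φ _ => hnn φ o)
  · have hne : ∑ φ ∈ Φ, ∑ ψ ∈ φ, ν ψ * density m ψ.1 π o ≠ 0 := fun h => ho (by simp [h])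
    simp only [posterior]
    rw [← Finset.sum_div, Finset.sum_coe_sort Φ fun φ => ∑ ψ ∈ φ, ν ψ * density m ψ.1 π o,
      div_self hne]

theorem sum_lintegral_finKL_posterior
    (hΦ : (Φ : Set (Finset (ι × Pol))).PairwiseDisjoint id) (hν : ν ∈ distOn (Φ.biUnion id))
    {ρ : Φ → ℝ} (hρ : ρ ∈ stdSimplex ℝ Φ) :
    ∑ ψ, ENNReal.ofReal (ν ψ) * ∫⁻ o, finKL (posterior m Φ ν π o) ρ ∂((m ψ.1).law π) =
      ∑ φ : Φ, klDiv (cellLaw m ν φ.1 π) (ENNReal.ofReal (ρ φ) • (mix m ν hν.1).law π) := by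
  have hpost := cellLaw_eq_withDensity_posterior m π hΦ hν
  have hfin : ∀ φ : Φ, IsFiniteMeasure (((mix m ν hν.1).law π).withDensity fun o =>
      ENNReal.ofReal (posterior m Φ ν π o φ)) := fun φ => hpost φ ▸ inferInstance
  calc _ = ∫⁻ o, finKL (posterior m Φ ν π o) ρ ∂((mix m ν hν.1).law π) := by
        simp only [mix, mixture, lintegral_finsetSum_measure, lintegral_smul_measure, smul_eq_mul]
    _ = _ := by
        rw [lintegral_finKL (fun φ => by unfold posterior; fun_prop)
          (posterior_mem_stdSimplex_ae m π hΦ hν) hρ]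
        simp only [hpost]

end Posterior

section CellDiv

variable {ι Pol O : Type*} [MeasurableSpace O] {Φ : Finset (Finset (ι × Pol))}
  {ν : ι × Pol → ℝ} (m : ι → Model Pol O) (N : Model Pol O) (π : Pol)

/-- The divergence of the joint law of observation and cell under `ν` from the law under which the
observation comes from `N`, independently of the cell. It is jointly convex in `ν`. -/
noncomputable def cellDiv (m : ι → Model Pol O) (Φ : Finset (Finset (ι × Pol))) (N : Model Pol O)
    (ν : ι × Pol → ℝ) (π : Pol) : ℝ≥0∞ :=
  ∑ φ : Φ, klDiv (cellLaw m ν φ.1 π) (ENNReal.ofReal (∑ ψ ∈ φ.1, ν ψ) • N.law π)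

lemma cellDiv_convexComb_le {ν' : ι × Pol → ℝ} (hν : ∀ ψ, 0 ≤ ν ψ) (hν' : ∀ ψ, 0 ≤ ν' ψ)
    {a b : ℝ} (ha : 0 ≤ a) (hb : 0 ≤ b) :
    cellDiv m Φ N (a • ν + b • ν') π ≤
      ENNReal.ofReal a * cellDiv m Φ N ν π + ENNReal.ofReal b * cellDiv m Φ N ν' π := by
  simp only [cellDiv, Finset.mul_sum, ← Finset.sum_add_distrib]
  refine Finset.sum_le_sum fun φ _ => ?_
  have hsum : ENNReal.ofReal (∑ ψ ∈ φ.1, (a • ν + b • ν') ψ) =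
      ENNReal.ofReal a * ENNReal.ofReal (∑ ψ ∈ φ.1, ν ψ) +
        ENNReal.ofReal b * ENNReal.ofReal (∑ ψ ∈ φ.1, ν' ψ) := by
    have h := Finset.sum_nonneg fun ψ (_ : ψ ∈ φ.1) => hν ψ
    have h' := Finset.sum_nonneg fun ψ (_ : ψ ∈ φ.1) => hν' ψ
    rw [← ENNReal.ofReal_mul ha, ← ENNReal.ofReal_mul hb,
      ← ENNReal.ofReal_add (by positivity) (by positivity)]
    simp [Finset.sum_add_distrib, Finset.mul_sum]
  rw [cellLaw_convexComb m hν hν' ha hb, hsum, add_smul, mul_smul, mul_smul]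
  exact (klDiv_add_le _ _ _ _).trans_eq
    (congrArg₂ _ (klDiv_smul_same a.toNNReal) (klDiv_smul_same b.toNNReal))

lemma cellDiv_eq_sum_condDist (hν : ∀ ψ, 0 ≤ ν ψ) :
    cellDiv m Φ N ν π = ∑ φ : Φ, ENNReal.ofReal (∑ ψ ∈ φ.1, ν ψ) *
      klDiv (cellLaw m (condDist ν φ.1) φ.1 π) (N.law π) := by
  refine Finset.sum_congr rfl fun φ _ => ?_
  rw [cellLaw_eq_smul_condDist m hν]
  exact klDiv_smul_same (∑ ψ ∈ φ.1, ν ψ).toNNReal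

variable [Fintype ι] [Fintype Pol]

lemma cellDiv_eq_klDiv_mix (hΦ : (Φ : Set (Finset (ι × Pol))).PairwiseDisjoint id)
    {φ : Finset (ι × Pol)} (hφ : φ ∈ Φ) (hν : ν ∈ distOn φ) :
    cellDiv m Φ N ν π = klDiv ((mix m ν hν.1).law π) (N.law π) := by
  rw [cellDiv, Fintype.sum_eq_single (⟨φ, hφ⟩ : Φ)]
  · rw [sum_eq_one_of_mem_distOn hν, ENNReal.ofReal_one, one_smul, cellLaw_eq_mix_law m hν]
  · intro φ' hne
    have hzero : ∀ ψ ∈ φ'.1, ν ψ = 0 := fun ψ hψ => hν.2 ψ <| Finset.disjoint_left.1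
      (hΦ φ'.2 hφ fun h => hne (Subtype.ext h)) hψ
    have hlaw : cellLaw m ν φ'.1 π = 0 := Finset.sum_eq_zero fun ψ hψ => by
      rw [hzero ψ hψ, ENNReal.ofReal_zero, zero_smul]
    rw [hlaw, Finset.sum_eq_zero hzero, ENNReal.ofReal_zero, zero_smul, klDiv_self]

variable [DecidableEq ι] [DecidableEq Pol]

lemma cellDiv_mix_le (hΦ : (Φ : Set (Finset (ι × Pol))).PairwiseDisjoint id)
    (hν : ν ∈ distOn (Φ.biUnion id)) {ρ : Φ → ℝ} (hρ : ρ ∈ stdSimplex ℝ Φ) :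
    cellDiv m Φ (mix m ν hν.1) ν π ≤
      ∑ ψ, ENNReal.ofReal (ν ψ) * ∫⁻ o, finKL (posterior m Φ ν π o) ρ ∂((m ψ.1).law π) := by
  rw [sum_lintegral_finKL_posterior m π hΦ hν hρ]
  refine Finset.sum_le_sum fun φ _ => ?_
  rw [← cellLaw_univ m hν.1.1 φ.1 π]
  exact klDiv_measure_univ_smul_le _ _ (ρ φ).toNNReal

lemma sum_lintegral_finKL_posterior_le (hΦ : (Φ : Set (Finset (ι × Pol))).PairwiseDisjoint id)
    (hν : ν ∈ distOn (Φ.biUnion id)) :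
    ∑ ψ, ENNReal.ofReal (ν ψ) * ∫⁻ o, finKL (posterior m Φ ν π o)
      (fun φ : Φ => ∑ ψ ∈ φ.1, ν ψ) ∂((m ψ.1).law π) ≤ cellDiv m Φ N ν π := by
  have hv := sum_cell_mem_stdSimplex hΦ hν
  rw [sum_lintegral_finKL_posterior m π hΦ hν hv, cellDiv,
    sum_klDiv_smul_eq_add (fun φ : Φ => cellLaw m ν φ.1 π) (N.law π) hv, sum_cellLaw m hΦ hν π]
  exact le_add_self

end CellDiv

section Value

variable {ι Pol O : Type*} [Fintype ι] [Fintype Pol] [MeasurableSpace O]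

lemma mix_mem_co (m : ι → Model Pol O) {S : Set (Model Pol O)} {φ : Finset (ι × Pol)}
    {ν : ι × Pol → ℝ} (hν : ν ∈ distOn φ) (hS : ∀ ψ ∈ φ, m ψ.1 ∈ S) : mix m ν hν.1 ∈ co S :=
  mixture_mem_co hν.1 fun ψ hψ => hS ψ (not_imp_comm.1 (hν.2 ψ) hψ)

variable [DecidableEq ι] [DecidableEq Pol]

-- The cell is found by averaging: conditioning on the cell splits both the gain and the divergence
-- from `M^ν` into averages over the cells.
theorem exists_cell_AIR_le_offset {η : ℝ} (hη : 0 < η) (m : ι → Model Pol O)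
    {Φ : Finset (Finset (ι × Pol))} (hΦ : (Φ : Set (Finset (ι × Pol))).PairwiseDisjoint id)
    {ν : ι × Pol → ℝ} (hν : ν ∈ distOn (Φ.biUnion id)) {ρ : Φ → ℝ} (hρ : ρ ∈ stdSimplex ℝ Φ)
    {p : Pol → ℝ} (hp : ∀ π, 0 ≤ p π) :
    ∃ φ ∈ Φ, ∃ (ν' : ι × Pol → ℝ) (hν' : ν' ∈ distOn φ), AIR η m Φ ρ p ν ≤
      offset η p (fun π => comparatorValue m ν' - (mix m ν' hν'.1).value π)
        (fun π => klDiv ((mix m ν' hν'.1).law π) ((mix m ν hν.1).law π)) := by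
  obtain ⟨φ, hφ, hle⟩ := exists_offset_sum_le (p := p) hη (sum_cell_mem_stdSimplex hΦ hν)
    (fun φ : Φ => gain m (condDist ν φ.1))
    fun φ π => klDiv (cellLaw m (condDist ν φ.1) φ.1 π) ((mix m ν hν.1).law π)
  have hν' : condDist ν φ.1 ∈ distOn φ.1 := condDist_mem_distOn hν.1.1 hφ
  refine ⟨φ.1, φ.2, condDist ν φ.1, hν', ?_⟩
  calc AIR η m Φ ρ p ν
      ≤ offset η p (gain m ν) (cellDiv m Φ (mix m ν hν.1) ν) :=
        offset_mono hp le_rfl fun π => cellDiv_mix_le m π hΦ hν hρ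
    _ ≤ offset η p (gain m (condDist ν φ.1))
          fun π => klDiv (cellLaw m (condDist ν φ.1) φ.1 π) ((mix m ν hν.1).law π) := by
        have hgain := funext (gain_eq_sum_cells m hΦ hν)
        have hdiv := funext fun π => cellDiv_eq_sum_condDist (Φ := Φ) m (mix m ν hν.1) π hν.1.1
        exact (congrArg₂ (offset η p) hgain hdiv).trans_le hle
    _ = _ := by simp only [cellLaw_eq_mix_law m hν', ← gain_eq_sub m hν'.1]

theorem AIRValue_le_DECPhi {η : ℝ} (hη : 0 < η) (m : ι → Model Pol O)
    {Φ : Finset (Finset (ι × Pol))} (hΦ : (Φ : Set (Finset (ι × Pol))).PairwiseDisjoint id) :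
    AIRValue η m Φ ≤ DECPhi η m Φ := by
  refine iSup₂_le fun ρ hρ => iSup₂_le fun ν hν => ?_
  have hmem : mix m ν hν.1 ∈ co (Set.range m) := mix_mem_co m hν fun ψ _ => Set.mem_range_self ψ.1
  refine le_iSup₂_of_le (mix m ν hν.1) hmem (iInf₂_mono fun p hp => ?_)
  obtain ⟨φ, hφ, ν', hν', hle⟩ := exists_cell_AIR_le_offset hη m hΦ hν hρ hp.1
  exact hle.trans (le_iSup₂_of_le φ hφ (le_iSup₂_of_le ν' hν' le_rfl))

lemma iInf_offset_cellDiv_le_AIRValue (η : ℝ) (m : ι → Model Pol O)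
    {Φ : Finset (Finset (ι × Pol))} (hΦ : (Φ : Set (Finset (ι × Pol))).PairwiseDisjoint id)
    (N : Model Pol O) {ν : ι × Pol → ℝ} (hν : ν ∈ distOn (Φ.biUnion id)) :
    ⨅ p ∈ stdSimplex ℝ Pol, offset η p (gain m ν) (cellDiv m Φ N ν) ≤ AIRValue η m Φ :=
  le_iSup₂_of_le (fun φ : Φ => ∑ ψ ∈ φ.1, ν ψ) (sum_cell_mem_stdSimplex hΦ hν) <|
    le_iSup₂_of_le ν hν <| iInf₂_mono fun _ hp =>
      offset_mono hp.1 le_rfl fun π => sum_lintegral_finKL_posterior_le m N π hΦ hν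

theorem coe_le_AIRValue {η : ℝ} (hη : 0 < η) (m : ι → Model Pol O)
    {Φ : Finset (Finset (ι × Pol))} (hΦ : (Φ : Set (Finset (ι × Pol))).PairwiseDisjoint id)
    {φ : Finset (ι × Pol)} (hφ : φ ∈ Φ) {ν : ι × Pol → ℝ} (hν : ν ∈ distOn φ)
    {c : ℝ} (hc : ∀ π, c ≤ gain m ν π) : (c : EReal) ≤ AIRValue η m Φ := by
  have hν' := distOn_mono (Finset.subset_biUnion_of_mem id hφ) hν
  refine le_trans (le_iInf₂ fun p hp => ?_)
    (iInf_offset_cellDiv_le_AIRValue η m hΦ (mix m ν hν.1) hν')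
  have hdiv : ∀ π, cellDiv m Φ (mix m ν hν.1) ν π = 0 := fun π => by
    rw [cellDiv_eq_klDiv_mix m _ π hΦ hφ hν, klDiv_self]
  calc (c : EReal) = ((∑ π, p π * c : ℝ) : EReal) := by rw [← Finset.sum_mul, hp.2, one_mul]
    _ ≤ offset η p (gain m ν) (cellDiv m Φ (mix m ν hν.1) ν) :=
        le_offset hη hp.1 hc fun π => (hdiv π).trans_le zero_le

variable [Nonempty Pol]

theorem DECPhi_le_AIRValue {η : ℝ} (hη : 0 < η) (m : ι → Model Pol O)
    {Φ : Finset (Finset (ι × Pol))} (hΦ : (Φ : Set (Finset (ι × Pol))).PairwiseDisjoint id) :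
    DECPhi η m Φ ≤ AIRValue η m Φ := by
  refine iSup₂_le fun N _ => ?_
  calc _ ≤ ⨅ p ∈ stdSimplex ℝ Pol, ⨆ ν ∈ distOn (Φ.biUnion id),
          offset η p (gain m ν) (cellDiv m Φ N ν) := by
        refine iInf₂_mono fun p _ => iSup₂_le fun φ hφ => iSup₂_le fun ν hν => ?_
        refine le_iSup₂_of_le ν (distOn_mono (Finset.subset_biUnion_of_mem id hφ) hν) (le_of_eq ?_)
        congr with π
        · rw [gain_eq_sub]
        · rw [cellDiv_eq_klDiv_mix m N π hΦ hφ hν]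
    _ ≤ ⨆ ν ∈ distOn (Φ.biUnion id), ⨅ p ∈ stdSimplex ℝ Pol,
          offset η p (gain m ν) (cellDiv m Φ N ν) :=
        iInf_iSup_offset_le hη (convex_distOn _) (concaveOn_gain m (convex_distOn _))
          (fun ν hν => gain_le_one m hν.1) fun ν hν ν' hν' a b ha hb _ π =>
            cellDiv_convexComb_le m N π hν.1.1 hν'.1.1 ha hb
    _ ≤ AIRValue η m Φ :=
        iSup₂_le fun ν hν => iInf_offset_cellDiv_le_AIRValue η m hΦ N hν

end Value

section Gap

variable {ι Pol O : Type*} [Fintype ι] [Fintype Pol] [Nonempty Pol] [MeasurableSpace O]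

lemma comparatorGap_bddAbove (m : ι → Model Pol O) (Φ : Finset (Finset (ι × Pol))) :
    BddAbove {x | ∃ φ ∈ Φ, ∃ (ν : ι × Pol → ℝ) (hν : ν ∈ distOn φ),
      x = comparatorValue m ν - (mix m ν hν.1).value (mix m ν hν.1).opt} := by
  refine ⟨1, ?_⟩
  rintro x ⟨φ, _, ν, hν, rfl⟩
  rw [← gain_eq_sub]
  exact gain_le_one m hν.1 _

lemma comparatorValue_le_add_comparatorGap (m : ι → Model Pol O) {Φ : Finset (Finset (ι × Pol))}
    {φ : Finset (ι × Pol)} (hφ : φ ∈ Φ) {ν : ι × Pol → ℝ} (hν : ν ∈ distOn φ) :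
    comparatorValue m ν ≤ (mix m ν hν.1).value (mix m ν hν.1).opt + comparatorGap m Φ :=
  sub_le_iff_le_add'.1 (le_csSup (comparatorGap_bddAbove m Φ) ⟨φ, hφ, ν, hν, rfl⟩)

theorem AIRValue_le_DEC_convexification [DecidableEq ι] [DecidableEq Pol] {η : ℝ} (hη : 0 < η)
    (m : ι → Model Pol O) {Φ : Finset (Finset (ι × Pol))}
    (hΦ : (Φ : Set (Finset (ι × Pol))).PairwiseDisjoint id) (hgap : comparatorGap m Φ ≤ 0) :
    AIRValue η m Φ ≤ DEC η (convexification m Φ) := by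
  refine iSup₂_le fun ρ hρ => iSup₂_le fun ν hν => ?_
  have hmem : mix m ν hν.1 ∈ co (convexification m Φ) := by
    refine mix_mem_co m hν fun ψ hψ => ?_
    obtain ⟨φ, hφ, hψφ⟩ := Finset.mem_biUnion.1 hψ
    exact Set.mem_biUnion hφ (subset_co _ ⟨ψ.1, ψ.2, hψφ, rfl⟩)
  refine le_iSup₂_of_le (mix m ν hν.1) hmem (iInf₂_mono fun p hp => ?_)
  obtain ⟨φ, hφ, ν', hν', hle⟩ := exists_cell_AIR_le_offset hη m hΦ hν hρ hp.1
  have hmem' : mix m ν' hν'.1 ∈ convexification m Φ :=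
    Set.mem_biUnion hφ (mix_mem_co m hν' fun ψ hψ => ⟨ψ.1, ψ.2, hψ, rfl⟩)
  refine hle.trans (le_iSup₂_of_le (mix m ν' hν'.1) hmem' ?_)
  refine offset_mono hp.1 (fun π => sub_le_sub_right ?_ _) le_rfl
  exact (comparatorValue_le_add_comparatorGap m hφ hν').trans (add_le_of_nonpos_right hgap)

lemma comparatorGap_nonpos_of_fixedComparator (m : ι → Model Pol O)
    {Φ : Finset (Finset (ι × Pol))} (h : FixedComparator Φ) : comparatorGap m Φ ≤ 0 := by
  refine Real.sSup_le ?_ le_rfl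
  rintro x ⟨φ, hφ, ν, hν, rfl⟩
  have hmem : ∀ ψ, ν ψ ≠ 0 → ψ ∈ φ := fun ψ => not_imp_comm.1 (hν.2 ψ)
  obtain ⟨ψ₀, -, hψ₀⟩ : ∃ ψ ∈ Finset.univ, ν ψ ≠ 0 :=
    Finset.exists_ne_zero_of_sum_ne_zero (hν.1.2.symm ▸ one_ne_zero)
  have hval : comparatorValue m ν = (mix m ν hν.1).value ψ₀.2 := by
    refine Finset.sum_congr rfl fun ψ _ => ?_
    rcases eq_or_ne (ν ψ) 0 with hψ | hψ
    · rw [hψ, zero_mul, zero_mul]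
    · rw [h φ hφ ψ (hmem ψ hψ) ψ₀ (hmem ψ₀ hψ₀)]
  exact sub_nonpos.2 (hval.trans_le (Model.value_le_opt _ _))

lemma comparatorValue_sub_opt_eq_iInf_gain (m : ι → Model Pol O) {ν : ι × Pol → ℝ}
    (hν : ν ∈ stdSimplex ℝ (ι × Pol)) :
    comparatorValue m ν - (mix m ν hν).value (mix m ν hν).opt = ⨅ π, gain m ν π := by
  simp only [gain_eq_sub m hν]
  refine le_antisymm (le_ciInf fun π => sub_le_sub_left (Model.value_le_opt _ π) _) ?_
  exact ciInf_le (Set.finite_range _).bddBelow _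

lemma continuous_iInf_gain (m : ι → Model Pol O) : Continuous fun ν => ⨅ π, gain m ν π := by
  simp only [← Finset.inf'_univ_eq_ciInf]
  refine Continuous.finset_inf'_apply _ fun π _ => ?_
  unfold gain
  fun_prop

theorem exists_comparatorGap_le_gain (m : ι → Model Pol O) {Φ : Finset (Finset (ι × Pol))}
    (h : 0 < comparatorGap m Φ) :
    ∃ φ ∈ Φ, ∃ ν ∈ distOn φ, ∀ π, comparatorGap m Φ ≤ gain m ν π := by
  have hgap : comparatorGap m Φ = sSup (⋃ φ ∈ Φ, (fun ν => ⨅ π, gain m ν π) '' distOn φ) := by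
    rw [comparatorGap]
    congr 1 with x
    simp [comparatorValue_sub_opt_eq_iInf_gain, eq_comm]
  have hne : (⋃ φ ∈ Φ, (fun ν => ⨅ π, gain m ν π) '' distOn φ).Nonempty := by
    refine Set.nonempty_iff_ne_empty.2 fun hempty => h.ne' ?_
    rw [hgap, hempty, Real.sSup_empty]
  have hcompact : IsCompact (⋃ φ ∈ Φ, (fun ν => ⨅ π, gain m ν π) '' distOn φ) :=
    Φ.isCompact_biUnion fun φ _ => (isCompact_distOn φ).image (continuous_iInf_gain m)
  obtain ⟨φ, hφ, ν, hν, hmax⟩ := Set.mem_iUnion₂.1 (hcompact.sSup_mem hne)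
  refine ⟨φ, hφ, ν, hν, fun π => ?_⟩
  rw [hgap, ← hmax]
  exact ciInf_le (Set.finite_range _).bddBelow π

end Gap
section Regret

variable {ι Pol O : Type*} [MeasurableSpace O]

/-- The instantaneous regret in a round. -/
def roundRegret (m : ι → Model Pol O) (x : Round ι Pol O) : ℝ :=
  (m x.1.1.1).value x.1.1.2 - (m x.1.1.1).value x.1.2

lemma abs_roundRegret_le (m : ι → Model Pol O) (x : Round ι Pol O) : |roundRegret m x| ≤ 1 := by
  obtain ⟨h0, h1⟩ := (m x.1.1.1).value_mem x.1.1.2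
  obtain ⟨h0', h1'⟩ := (m x.1.1.1).value_mem x.1.2
  rw [roundRegret, abs_le]
  constructor <;> linarith

lemma measurable_snoc {X : Type*} [MeasurableSpace X] (t : ℕ) :
    Measurable fun x : (Fin t → X) × X => (Fin.snoc x.1 x.2 : Fin (t + 1) → X) := by
  refine measurable_pi_iff.2 fun s => ?_
  induction s using Fin.lastCases with
  | last => simpa using measurable_snd
  | cast s =>
    simp only [Fin.snoc_castSucc]
    fun_prop

lemma integral_weightMeasure {κ : Type*} [Fintype κ] [MeasurableSpace κ]
    [MeasurableSingletonClass κ] {ν : κ → ℝ} (hν : ∀ k, 0 ≤ ν k) (f : κ → ℝ) :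
    ∫ k, f k ∂(weightMeasure ν) = ∑ k, ν k * f k := by
  rw [weightMeasure, integral_finsetSum_measure]
  · refine Finset.sum_congr rfl fun k _ => ?_
    rw [integral_smul_measure, integral_dirac, ENNReal.toReal_ofReal (hν k), smul_eq_mul]
  · exact fun k _ => (integrable_dirac enorm_lt_top).smul_measure ENNReal.ofReal_ne_top

variable [MeasurableSpace ι] [MeasurableSingletonClass ι] [MeasurableSpace Pol]
  [MeasurableSingletonClass Pol] (m : ι → Model Pol O)

@[fun_prop]
lemma measurable_roundRegret [Countable ι] [Countable Pol] : Measurable (roundRegret m) :=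
  (measurable_of_countable fun x : (ι × Pol) × Pol =>
    (m x.1.1).value x.1.2 - (m x.1.1).value x.2).comp measurable_fst

lemma integrable_roundRegret [Countable ι] [Countable Pol] {Ω : Type*} [MeasurableSpace Ω]
    (P : Measure Ω) [IsFiniteMeasure P] {f : Ω → Round ι Pol O} (hf : Measurable f) :
    Integrable (fun ω => roundRegret m (f ω)) P :=
  Integrable.of_bound ((measurable_roundRegret m).comp hf).aestronglyMeasurable 1
    (ae_of_all _ fun ω => abs_roundRegret_le m (f ω))

variable [Fintype ι] [Fintype Pol] {Φ : Finset (Finset (ι × Pol))} (E : Environment O Φ)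
  (L : Learner Pol O)

instance : IsMarkovKernel (obsKernel m) :=
  ⟨fun x => (m x.1.1).isProb x.2⟩

instance (t : ℕ) : IsMarkovKernel (stepKernel m E L t) := by
  have := E.markov t
  have := L.markov t
  unfold stepKernel
  infer_instance

instance (t : ℕ) : IsProbabilityMeasure (historyLaw m E L t) := by
  induction t with
  | zero => rw [historyLaw]; infer_instance
  | succ t ih =>
    rw [historyLaw]
    exact Measure.isProbabilityMeasure_map (measurable_snoc t).aemeasurable

lemma expectedRegret_succ (t : ℕ) :
    expectedRegret m E L (t + 1) = expectedRegret m E L t +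
      ∫ h, ∫ x, roundRegret m x ∂(stepKernel m E L t h) ∂(historyLaw m E L t) := by
  set P := historyLaw m E L t ⊗ₘ stepKernel m E L t with hP
  have hlast : Integrable (fun x => roundRegret m x.2) P :=
    integrable_roundRegret m P measurable_snd
  have hpast : Integrable (fun x => ∑ s, roundRegret m (x.1 s)) P :=
    integrable_finsetSum _ fun s _ => integrable_roundRegret m P (by fun_prop)
  have hmeas : Measurable fun h : Fin (t + 1) → Round ι Pol O => ∑ s, roundRegret m (h s) := by
    fun_prop
  calc expectedRegret m E L (t + 1)
      = ∫ h, ∑ s, roundRegret m (h s) ∂(historyLaw m E L (t + 1)) := rfl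
    _ = ∫ x, ((∑ s, roundRegret m (x.1 s)) + roundRegret m x.2) ∂P := by
        rw [historyLaw, integral_map (measurable_snoc t).aemeasurable hmeas.aestronglyMeasurable]
        simp only [Fin.sum_univ_castSucc, Fin.snoc_castSucc, Fin.snoc_last, hP]
    _ = ∫ h, ∑ s, roundRegret m (h s) ∂(historyLaw m E L t) +
          ∫ h, ∫ x, roundRegret m x ∂(stepKernel m E L t h) ∂(historyLaw m E L t) := by
        rw [integral_add hpast hlast, Measure.integral_compProd hpast,
          Measure.integral_compProd hlast]
        simp only [integral_const, probReal_univ, one_smul]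

lemma mul_le_expectedRegret {c : ℝ}
    (hc : ∀ t h, c ≤ ∫ x, roundRegret m x ∂(stepKernel m E L t h)) (T : ℕ) :
    c * T ≤ expectedRegret m E L T := by
  induction T with
  | zero => simp [expectedRegret]
  | succ T ih =>
    have hint : Integrable (fun h => ∫ x, roundRegret m x ∂(stepKernel m E L T h))
        (historyLaw m E L T) :=
      (integrable_roundRegret m (historyLaw m E L T ⊗ₘ stepKernel m E L T)
        measurable_snd).integral_compProd
    have hround : c ≤ ∫ h, ∫ x, roundRegret m x ∂(stepKernel m E L T h) ∂(historyLaw m E L T) :=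
      calc c = ∫ _, c ∂(historyLaw m E L T) := by simp
        _ ≤ _ := integral_mono (integrable_const c) hint (hc T)
    rw [expectedRegret_succ, Nat.cast_succ, mul_add_one]
    exact add_le_add ih hround

/-- The environment that draws its pairs independently from a distribution on a cell. -/
noncomputable def iidEnvironment (O : Type*) [MeasurableSpace O] {φ : Finset (ι × Pol)}
    (hφ : φ ∈ Φ) {ν : ι × Pol → ℝ} (hν : ν ∈ distOn φ) : Environment O Φ where
  cell := φ
  cell_mem := hφ
  select _ := Kernel.const _ (weightMeasure ν)
  markov _ := by
    have := isProbabilityMeasure_weightMeasure hν.1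
    infer_instance
  select_mem _ h := by
    rw [Kernel.const_apply, ae_iff, weightMeasure, Measure.coe_finsetSum, Finset.sum_apply]
    refine Finset.sum_eq_zero fun ψ _ => ?_
    by_cases hψ : ψ ∈ φ
    · simp [hψ]
    · simp [hν.2 ψ hψ]

lemma integral_roundRegret_stepKernel_iidEnvironment {φ : Finset (ι × Pol)} (hφ : φ ∈ Φ)
    {ν : ι × Pol → ℝ} (hν : ν ∈ distOn φ) (t : ℕ) (h : Fin t → Round ι Pol O) :
    ∫ x, roundRegret m x ∂(stepKernel m (iidEnvironment O hφ hν) L t h) =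
      ∫ π, gain m ν π ∂(L.act t fun s => ((h s).1.2, (h s).2)) := by
  have := L.markov t
  have := (iidEnvironment O hφ hν).markov t
  have hint : Integrable (roundRegret m) (stepKernel m (iidEnvironment O hφ hν) L t h) :=
    integrable_roundRegret m _ measurable_id
  have hobs : ∀ x : (ι × Pol) × Pol, ∫ o, roundRegret m (x, o) ∂((obsKernel m).prodMkLeft
      (Fin t → Round ι Pol O) (h, x)) = (m x.1.1).value x.1.2 - (m x.1.1).value x.2 := by
    simp [roundRegret]
  rw [stepKernel] at hint ⊢
  rw [ProbabilityTheory.integral_compProd hint]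
  simp only [hobs]
  rw [Kernel.prod_apply, integral_prod_symm _ Integrable.of_finite]
  exact integral_congr_ae (ae_of_all _ fun π => integral_weightMeasure hν.1.1 _)

theorem mul_le_expectedRegret_iidEnvironment {φ : Finset (ι × Pol)} (hφ : φ ∈ Φ)
    {ν : ι × Pol → ℝ} (hν : ν ∈ distOn φ) {c : ℝ} (hc : ∀ π, c ≤ gain m ν π) (T : ℕ) :
    c * T ≤ expectedRegret m (iidEnvironment O hφ hν) L T := by
  refine mul_le_expectedRegret m _ L (fun t h => ?_) T
  have := L.markov t
  rw [integral_roundRegret_stepKernel_iidEnvironment]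
  calc c = ∫ _, c ∂(L.act t fun s => ((h s).1.2, (h s).2)) := by simp
    _ ≤ _ := integral_mono (integrable_const c) Integrable.of_finite hc

end Regret

end DecisionMaking

theorem lemma2 {ι Pol O : Type*} [Fintype ι] [DecidableEq ι] [MeasurableSpace ι]
    [MeasurableSingletonClass ι] [Fintype Pol] [DecidableEq Pol] [Nonempty Pol]
    [MeasurableSpace Pol] [MeasurableSingletonClass Pol] [MeasurableSpace O]
    (m : ι → DecisionMaking.Model Pol O) (Φ : Finset (Finset (ι × Pol)))
    (hΦ : (Φ : Set (Finset (ι × Pol))).PairwiseDisjoint id) :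
    (∀ η : ℝ, 0 < η →
      DecisionMaking.AIRValue η m Φ = DecisionMaking.DECPhi η m Φ) ∧
    (DecisionMaking.comparatorGap m Φ ≤ 0 → ∀ η : ℝ, 0 < η →
      DecisionMaking.AIRValue η m Φ ≤
        DecisionMaking.DEC η (DecisionMaking.convexification m Φ)) ∧
    (0 < DecisionMaking.comparatorGap m Φ →
      ¬ DecisionMaking.FixedComparator Φ ∧
      (∀ η : ℝ, 0 < η →
        ((DecisionMaking.comparatorGap m Φ : ℝ) : EReal) ≤ DecisionMaking.AIRValue η m Φ) ∧
      ∃ E : DecisionMaking.Environment O Φ, ∀ (L : DecisionMaking.Learner Pol O) (T : ℕ),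
        DecisionMaking.comparatorGap m Φ * T ≤ DecisionMaking.expectedRegret m E L T) := by
  refine ⟨fun η hη => le_antisymm (DecisionMaking.AIRValue_le_DECPhi hη m hΦ)
      (DecisionMaking.DECPhi_le_AIRValue hη m hΦ),
    fun hgap η hη => DecisionMaking.AIRValue_le_DEC_convexification hη m hΦ hgap, fun hgap => ?_⟩
  obtain ⟨φ, hφ, ν, hν, hle⟩ := DecisionMaking.exists_comparatorGap_le_gain m hgap
  exact ⟨fun h => (DecisionMaking.comparatorGap_nonpos_of_fixedComparator m h).not_gt hgap,
    fun η hη => DecisionMaking.coe_le_AIRValue hη m hΦ hφ hν hle,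
    DecisionMaking.iidEnvironment O hφ hν, fun L T =>
      DecisionMaking.mul_le_expectedRegret_iidEnvironment m L hφ hν hle T⟩
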